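/- All codes are binary and linear, that is, subspaces $C$ of $\mathbb{F}_2^n$; $\mathrm{wt}$ is the Hamming weight and $\perp$ refers to the standard bilinear form. A self-dual code ($C=C^\perp$) is singly-even if some codeword has weight not divisible by $4$ (all weights being even). A self-dual code of length $n\not\equiv 22 \pmod{24}$ is extremal if its minimum distance is $4\lfloor n/24\rfloor+4$. Let $C_0=\{c\in C: 4\mid \mathrm{wt}(c)\}$. The shadow of $C$ is $S=C_0^\perp\setminus C$. Write $n=24m+8l+2r$ with $l\in\{0,1,2\}$ and $r\in\{0,1,2,3\}$. Then $C$ has minimal shadow if the minimum weight of $S$ is $r$ when $r\ne 0$, and $4$ when $r=0$. Let $b_j$ be the number of vectors of weight $4j+r$ in $S$. **Corollary.** There are no extremal singly-even self-dual codes with minimal shadow of length $n$ if (i) $n=24m+8$ and $m\ge 53$; (ii) $n=24m+12$ and $m\ge 142$; (iii) $n=24m+14$ and $m\ge 146$; (iv) $n=24m+18$ and $m\ge 157$. More precisely, for every $m\ge 1$, every extremal singly-even self-dual code with minimal shadow of length $n$ satisfies (i) if $n=24m+8$: $$b_{m+1}=\frac{16(6m+1)(-4m^3+209m^2+141m+24)}{5m(m+1)(4m+3)}\binom{5m+1}{m-1};$$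 (ii) if $n=24m+12$: $$b_{m+1}=\frac{2(12m+5)(-32m^4+4496m^3+4242m^2+1257m+117)}{(5m+1)(4m+3)(4m+5)(2m+3)}\binom{5m+2}{m+1};$$ (iii) if $n=24m+14$: $$b_{m+1}=\frac{2(-5376m^6+772352m^5+1663728m^4+1386448m^3+557970m^2+107643m+7875)}{(4m+3)(4m+5)(2m+3)(4m+7)(5m+1)}\binom{5m+2}{m+1};$$ (iv) if $n=24m+18$: $$b_{m+2}=\frac{2(24m+17)(-544m^5+83696m^4+184210m^3+149089m^2+52809m+6930)}{(4m+5)(2m+3)(4m+7)(4m+9)(5m+2)}\binom{5m+3}{m+2};$$ and the right-hand sides are negative for $m\ge 53$, $m\ge 142$, $m\ge 146$ and $m\ge 157$, respectively. -/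

import Mathlib

/-- Binary linear codes of length `n` are the subspaces of `F_2^n`. -/
abbrev BinaryCode (n : ℕ) : Type := Submodule (ZMod 2) (Fin n → ZMod 2)

/-- The dual `S^⊥` of a set `S` of binary vectors, for the standard bilinear form. -/
def dualCode {n : ℕ} (S : Set (Fin n → ZMod 2)) : BinaryCode n where
  carrier := {v | ∀ c ∈ S, ∑ i, v i * c i = 0}
  add_mem' := by
    intro a b ha hb c hc
    simp only [Pi.add_apply, add_mul, Finset.sum_add_distrib]
    rw [ha c hc, hb c hc, add_zero]
  zero_mem' := by
    intro c _
    simp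
  smul_mem' := by
    intro t a ha c hc
    simp only [Pi.smul_apply, smul_eq_mul, mul_assoc, ← Finset.mul_sum]
    rw [ha c hc, mul_zero]

/-- `C` is self-dual: `C^⊥ = C`. -/
def IsSelfDualCode {n : ℕ} (C : BinaryCode n) : Prop :=
  dualCode (C : Set (Fin n → ZMod 2)) = C

/-- `C` is singly-even: all weights are even and some weight is not divisible by `4`. -/
def IsSinglyEven {n : ℕ} (C : BinaryCode n) : Prop :=
  (∀ c ∈ C, 2 ∣ hammingNorm c) ∧ ∃ c ∈ C, ¬ 4 ∣ hammingNorm c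

/-- The minimum distance of the linear code `C` is `d`: the least weight of a nonzero codeword
exists and equals `d`. -/
def HasMinDistance {n : ℕ} (C : BinaryCode n) (d : ℕ) : Prop :=
  IsLeast {w | ∃ c ∈ C, c ≠ 0 ∧ hammingNorm c = w} d

/-- The minimum distance of an extremal self-dual code of length `n`. -/
def extremalDistance (n : ℕ) : ℕ :=
  if n % 24 = 22 then 4 * (n / 24) + 6 else 4 * (n / 24) + 4

/-- The set `C_0` of the codewords of `C` of weight divisible by `4`
(the doubly-even subcode, when `C` is self-dual). -/
def doublyEvenPart {n : ℕ} (C : BinaryCode n) : Set (Fin n → ZMod 2) :=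
  {c | c ∈ C ∧ 4 ∣ hammingNorm c}

/-- The shadow `C_0^⊥ \ C`. -/
def shadow {n : ℕ} (C : BinaryCode n) : Set (Fin n → ZMod 2) :=
  (dualCode (doublyEvenPart C) : Set (Fin n → ZMod 2)) \ (C : Set (Fin n → ZMod 2))

/-- The least weight that a shadow may have: writing `n = 24m + 8l + 2r` with `l ∈ {0, 1, 2}` and
`r ∈ {0, 1, 2, 3}`, it is `r` if `r ≠ 0` and `4` if `r = 0`. -/
def minimalShadowWeight (n : ℕ) : ℕ :=
  if n % 8 / 2 = 0 then 4 else n % 8 / 2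

/-- `C` is a code with minimal shadow: the minimum weight of its shadow is the smallest possible. -/
def HasMinimalShadow {n : ℕ} (C : BinaryCode n) : Prop :=
  IsLeast {w | ∃ v ∈ shadow C, hammingNorm v = w} (minimalShadowWeight n)

/-- Extremal singly-even self-dual codes with minimal shadow. -/
structure IsExtremalWithMinimalShadow {n : ℕ} (C : BinaryCode n) : Prop where
  selfDual : IsSelfDualCode C
  singlyEven : IsSinglyEven C
  extremal : HasMinDistance C (extremalDistance n)
  minimalShadow : HasMinimalShadow C

/-- The coefficient `b_j` of the weight enumerator `∑ j, b_j y^(4j + r)` of the shadow of `C`, for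
a code of length `24m + 8l + 2r`: the number of shadow vectors of weight `4j + r`. -/
noncomputable def shadowCoeff {n : ℕ} (C : BinaryCode n) (j : ℕ) : ℕ :=
  Set.ncard {v | v ∈ shadow C ∧ hammingNorm v = 4 * j + n % 8 / 2}

/-- The value of `b_{m+1}` for length `24m + 8`, where `m ≥ 1`. -/
def forcedCoeff8 (m : ℕ) : ℚ :=
  16 * (6 * m + 1) * (-4 * m ^ 3 + 209 * m ^ 2 + 141 * m + 24)
    / (5 * m * (m + 1) * (4 * m + 3)) * (Nat.choose (5 * m + 1) (m - 1) : ℚ)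

/-- The value of `b_{m+1}` for length `24m + 12`. -/
def forcedCoeff12 (m : ℕ) : ℚ :=
  2 * (12 * m + 5) * (-32 * m ^ 4 + 4496 * m ^ 3 + 4242 * m ^ 2 + 1257 * m + 117)
    / ((5 * m + 1) * (4 * m + 3) * (4 * m + 5) * (2 * m + 3))
    * (Nat.choose (5 * m + 2) (m + 1) : ℚ)

/-- The value of `b_{m+1}` for length `24m + 14`. -/
def forcedCoeff14 (m : ℕ) : ℚ :=
  2 * (-5376 * m ^ 6 + 772352 * m ^ 5 + 1663728 * m ^ 4 + 1386448 * m ^ 3 + 557970 * m ^ 2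
      + 107643 * m + 7875)
    / ((4 * m + 3) * (4 * m + 5) * (2 * m + 3) * (4 * m + 7) * (5 * m + 1))
    * (Nat.choose (5 * m + 2) (m + 1) : ℚ)

/-- The value of `b_{m+2}` for length `24m + 18`. -/
def forcedCoeff18 (m : ℕ) : ℚ :=
  2 * (24 * m + 17) * (-544 * m ^ 5 + 83696 * m ^ 4 + 184210 * m ^ 3 + 149089 * m ^ 2
      + 52809 * m + 6930)
    / ((4 * m + 5) * (2 * m + 3) * (4 * m + 7) * (4 * m + 9) * (5 * m + 2))
    * (Nat.choose (5 * m + 3) (m + 2) : ℚ)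

/-! ### Lagrange inversion for the two expansions of the enumerators. -/

section PowerSeriesInversion

open PowerSeries

/-! Gleason's theorem writes the weight enumerator of a self-dual code of length `2N`, in the square
of the usual variable, as a combination of the products `(1 + X) ^ (N - 4j) * (X * (1 - X) ^ 2) ^ j`
with unknown coefficients `a j`. The same `a j` determine the shadow enumerator
(`exists_gleason_expansion`), and they are constrained from both ends.

On the code side, minimum distance `4m + 4` fixes `a 0, ..., a (2m + 1)`. On the shadow side, two
shadow vectors sum to a codeword, so a shadow vector of minimal weight is alone among the small
weights, and `b_0, ..., b_(M-1)` are known: all zero, except for a single 1 if the minimal weight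
falls in this range (`shadowCoeff_eq_ite`). The value of `a (2m + 1)` in terms of the shadow
involves only `b_0, ..., b_M`, and that of `a (2m)` only one coefficient more. Equating the two
descriptions of `a (2m + 1)` gives `b_M`; then those of `a (2m)` give `b_(M+1)`
(`shadowCoeff_eq_of_sparse`).

Both descriptions come from Lagrange inversion (`coeff_sum_mul_lagrange`), which leaves coefficients
of products of powers of `1 + X` and `1 - X`. These are rational multiples of `choose (5m) m`, and
collecting them gives the closed forms. Their polynomial factor has negative leading coefficient, so
for large `m` a number of vectors would be negative. -/

/-- Lagrange inversion for finite expansions in powers of `X * u`. -/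
theorem coeff_sum_mul_lagrange {u v : ℚ⟦X⟧} (huv : u * v = 1) (a : ℕ → ℚ) {K i : ℕ} (hi : i ≤ K) :
    coeff i ((∑ j ∈ Finset.range (K + 1), C (a j) * (X * u) ^ j) *
      (C (i : ℚ) * v ^ i - X * derivative ℚ (v ^ i))) = i * a i := by
  -- With `z = X * u`, the second factor is `-X ^ (i + 1)` times the derivative of `z ^ (-i)`. The
  -- coefficient is thus the residue of `i z ^ (j - i - 1) dz`, which is exact unless `j = i`.
  have key : ∀ j, coeff i ((X * u) ^ j * (C (i : ℚ) * v ^ i - X * derivative ℚ (v ^ i))) =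
      if j = i then (i : ℚ) else 0 := by
    intro j
    rcases lt_or_ge i j with h | h
    · rw [if_neg (by omega), mul_pow, mul_assoc, coeff_X_pow_mul', if_neg (by omega)]
    obtain ⟨k, rfl⟩ := Nat.exists_eq_add_of_le h
    have hu : u ^ j * v ^ j = 1 := by rw [← mul_pow, huv, one_pow]
    rw [mul_pow, mul_assoc, add_comm j k, coeff_X_pow_mul]
    rcases Nat.eq_zero_or_pos k with rfl | hk
    · rw [if_pos (by omega), mul_sub, mul_left_comm, zero_add, hu, mul_left_comm, map_sub]
      simp
    · rw [if_neg (by omega)]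
      obtain ⟨k, rfl⟩ := Nat.exists_eq_succ_of_ne_zero hk.ne'
      -- After cancelling `u ^ j`, the factor for `i` is a multiple of the factor for `i - j = k +
      -- 1`, whose coefficient in degree `k + 1` vanishes since `X * d/dX` multiplies that
      -- coefficient by `k + 1`.
      have h1 : u ^ j * (C ((k + 1 + j : ℕ) : ℚ) * v ^ (k + 1 + j)
            - X * derivative ℚ (v ^ (k + 1 + j)))
          = C (((k + 1 + j : ℕ) : ℚ) / (k + 1)) *
            (C ((k + 1 : ℕ) : ℚ) * v ^ (k + 1) - X * derivative ℚ (v ^ (k + 1))) := by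
        have h2 : (C (((k + 1 + j : ℕ) : ℚ) / (k + 1)) : ℚ⟦X⟧) * C ((k + 1 : ℕ) : ℚ)
            = C ((k + 1 + j : ℕ) : ℚ) := by
          rw [← map_mul]; congr 1; push_cast; field_simp
        have h3 : ∀ n : ℕ, ((n : ℕ) : ℚ⟦X⟧) = C (n : ℚ) := fun n => by simp
        rw [derivative_pow, derivative_pow, show k + 1 + j - 1 = k + j by omega,
          Nat.add_sub_cancel, h3, h3]
        rw [mul_sub, mul_sub, ← mul_assoc (C (((k + 1 + j : ℕ) : ℚ) / (k + 1))), h2]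
        linear_combination (C ((k + 1 + j : ℕ) : ℚ) * (v ^ (k + 1) - X * v ^ k * derivative ℚ v)) * hu
          + X * v ^ k * derivative ℚ v * h2
      rw [h1, coeff_C_mul, map_sub, coeff_C_mul, coeff_succ_X_mul, coeff_derivative]
      push_cast; ring
  rw [Finset.sum_mul, map_sum]
  simp_rw [mul_assoc, coeff_C_mul, key]
  rw [Finset.sum_eq_single i]
  · simp [mul_comm]
  · intro j _ hj; simp [hj]
  · intro h; exact absurd (Finset.mem_range.2 (by omega)) h

theorem one_add_X_mul_inv : (1 + X : ℚ⟦X⟧) * (1 + X)⁻¹ = 1 :=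
  PowerSeries.mul_inv_cancel _ (by simp)

theorem one_sub_X_mul_inv : (1 - X : ℚ⟦X⟧) * (1 - X)⁻¹ = 1 :=
  PowerSeries.mul_inv_cancel _ (by simp)

/-- Integration by parts: `i * f - X * f'` has no term of degree `i`, applied to `f = e * w`. -/
theorem mul_lagrange_eq (i : ℕ) (e w : ℚ⟦X⟧) :
    coeff i (e * (C (i : ℚ) * w - X * derivative ℚ w)) = coeff i (X * (derivative ℚ e * w)) := by
  have h : e * (C (i : ℚ) * w - X * derivative ℚ w)
      = C (i : ℚ) * (e * w) - X * derivative ℚ (e * w) + X * (derivative ℚ e * w) := by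
    rw [Derivation.leibniz]; simp only [smul_eq_mul]; ring
  rw [h, map_add, map_sub, coeff_C_mul]
  cases i with
  | zero => simp
  | succ i => rw [coeff_succ_X_mul (n := i) (φ := derivative ℚ _), coeff_derivative]; push_cast; ring

/-- The coefficients of an invariant polynomial `1 + O(X ^ (i + 1))` in terms of `1 + X` and
`X * (1 - X) ^ 2`. -/
theorem gleasonCoeff_eq {N K i : ℕ} (hK : 4 * K ≤ N) (hi : i ≤ K) (a : ℕ → ℚ) (h : ℚ⟦X⟧)
    (hp : ∑ j ∈ Finset.range (K + 1), C (a j) * ((1 + X) ^ (N - 4 * j) * (X * (1 - X) ^ 2) ^ j)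
      = 1 + X ^ (i + 1) * h) :
    (i : ℚ) * a i = - N * coeff i (X * ((1 + X)⁻¹ ^ (N + 1 - 4 * i) * (1 - X)⁻¹ ^ (2 * i))) := by
  set E : ℚ⟦X⟧ := (1 + X)⁻¹ with hE
  set F : ℚ⟦X⟧ := (1 - X)⁻¹ with hF
  have hE1 : (1 + X) * E = 1 := one_add_X_mul_inv
  have hF1 : (1 - X) * F = 1 := one_sub_X_mul_inv
  -- Dividing by `(1 + X) ^ N` turns the expansion into one in powers of `X * (1 - X) ^ 2 / (1 + X)
  -- ^ 4`.
  have huv : ((1 - X) ^ 2 * E ^ 4) * ((1 + X) ^ 4 * F ^ 2) = 1 := by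
    have : ((1 - X) ^ 2 * E ^ 4) * ((1 + X) ^ 4 * F ^ 2) = ((1 + X) * E) ^ 4 * ((1 - X) * F) ^ 2 := by
      ring
    rw [this, hE1, hF1]; simp
  rw [← coeff_sum_mul_lagrange huv a hi]
  have hf : ∑ j ∈ Finset.range (K + 1), C (a j) * (X * ((1 - X) ^ 2 * E ^ 4)) ^ j
      = E ^ N + X ^ (i + 1) * (h * E ^ N) := by
    have : E ^ N + X ^ (i + 1) * (h * E ^ N) = (1 + X ^ (i + 1) * h) * E ^ N := by ring
    rw [this, ← hp, Finset.sum_mul]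
    refine Finset.sum_congr rfl fun j hj => ?_
    have hj' : 4 * j ≤ N := by have := Finset.mem_range.1 hj; omega
    obtain ⟨k, rfl⟩ := Nat.exists_eq_add_of_le hj'
    have h1 : (1 + X) ^ k * E ^ k = 1 := by rw [← mul_pow, hE1, one_pow]
    rw [Nat.add_sub_cancel_left, pow_add E, mul_pow X, mul_pow X, mul_pow _ (E ^ 4), ← pow_mul E]
    linear_combination (- C (a j) * (X ^ j * ((1 - X) ^ 2) ^ j) * E ^ (4 * j)) * h1
  -- The tail `X ^ (i + 1) * h` starts above degree `i`, so only `(1 + X) ^ (-N)` contributes.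
  rw [hf, add_mul, map_add, mul_assoc (X ^ (i + 1)), coeff_X_pow_mul', if_neg (by omega), add_zero,
    mul_lagrange_eq]
  have hd : derivative ℚ E = - E ^ 2 := by
    rw [hE, derivative_inv']; simp
  have hN : 4 * i ≤ N := by omega
  obtain ⟨k, rfl⟩ := Nat.exists_eq_add_of_le hN
  have h1 : (1 + X) ^ (4 * i) * E ^ (4 * i) = 1 := by rw [← mul_pow, hE1, one_pow]
  have : X * (derivative ℚ (E ^ (4 * i + k)) * ((1 + X) ^ 4 * F ^ 2) ^ i)
      = C (-(4 * i + k : ℕ) : ℚ) * (X * (E ^ (4 * i + k + 1 - 4 * i) * F ^ (2 * i))) := by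
    rw [derivative_pow, hd, show 4 * i + k + 1 - 4 * i = k + 1 by omega]
    rcases Nat.eq_zero_or_pos (4 * i + k) with h0 | h0
    · rw [h0]; simp
    have h2 : E ^ (4 * i + k - 1) * E ^ 2 = E ^ (4 * i) * E ^ (k + 1) := by
      rw [← pow_add, ← pow_add]; congr 1; omega
    have h3 : (((4 * i + k : ℕ)) : ℚ⟦X⟧) = C ((4 * i + k : ℕ) : ℚ) := (map_natCast C _).symm
    rw [h3, map_neg, mul_pow _ (F ^ 2), ← pow_mul, ← pow_mul]
    linear_combination (-C ((4 * i + k : ℕ) : ℚ) * X * (1 + X) ^ (4 * i) * F ^ (2 * i)) * h2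
      - (C ((4 * i + k : ℕ) : ℚ) * X * E ^ (k + 1) * F ^ (2 * i)) * h1
  rw [this, coeff_C_mul]

/-- The coefficients of an expansion in terms of `X` and `(1 - X) ^ 2`. -/
theorem shadowExpansion_coeff_eq {K i : ℕ} (hi : i ≤ K) (hi0 : 0 < i) (c : ℕ → ℚ) (B : ℚ⟦X⟧)
    (hB : ∑ j ∈ Finset.range (K + 1), C (c j) * (X ^ j * (1 - X) ^ (2 * (K - j))) = B) :
    c i = coeff i (B * ((1 + X) * (1 - X)⁻¹ ^ (2 * (K - i) + 1))) := by
  set F : ℚ⟦X⟧ := (1 - X)⁻¹ with hF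
  have hF1 : (1 - X) * F = 1 := one_sub_X_mul_inv
  -- Dividing by `(1 - X) ^ (2K)` gives an expansion in powers of `X / (1 - X) ^ 2`.
  have huv : F ^ 2 * (1 - X) ^ 2 = 1 := by rw [← mul_pow, mul_comm F, hF1, one_pow]
  have hi' : (i : ℚ) ≠ 0 := by positivity
  have key := coeff_sum_mul_lagrange huv c hi
  have hf : ∑ j ∈ Finset.range (K + 1), C (c j) * (X * F ^ 2) ^ j = B * F ^ (2 * K) := by
    rw [← hB, Finset.sum_mul]
    refine Finset.sum_congr rfl fun j hj => ?_
    obtain ⟨k, rfl⟩ := Nat.exists_eq_add_of_le (Nat.lt_succ_iff.1 (Finset.mem_range.1 hj))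
    have h1 : (1 - X) ^ (2 * k) * F ^ (2 * k) = 1 := by rw [← mul_pow, hF1, one_pow]
    rw [Nat.add_sub_cancel_left, mul_add, pow_add]
    linear_combination (- C (c j) * X ^ j * F ^ (2 * j)) * h1
  rw [hf] at key
  obtain ⟨k, rfl⟩ := Nat.exists_eq_add_of_le hi
  obtain ⟨i, rfl⟩ := Nat.exists_eq_succ_of_ne_zero hi0.ne'
  have h1 : (1 - X) ^ (2 * i + 1) * F ^ (2 * i + 1) = 1 := by rw [← mul_pow, hF1, one_pow]
  -- The Lagrange factor simplifies to `(i + 1) * (1 + X) * (1 - X) ^ (2i + 1)`.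
  have h2 : B * F ^ (2 * (i + 1 + k)) * (C ((i + 1 : ℕ) : ℚ) * ((1 - X) ^ 2) ^ (i + 1)
        - X * derivative ℚ (((1 - X) ^ 2) ^ (i + 1)))
      = C ((i + 1 : ℕ) : ℚ) * (B * ((1 + X) * F ^ (2 * k + 1))) := by
    have h3 : ((2 * (i + 1) : ℕ) : ℚ⟦X⟧) = 2 * C ((i + 1 : ℕ) : ℚ) := by simp
    rw [← pow_mul, derivative_pow, h3, map_sub, derivative_one, derivative_X,
      show 2 * (i + 1) - 1 = 2 * i + 1 by omega]
    linear_combination (C ((i + 1 : ℕ) : ℚ) * B * (1 + X) * F ^ (2 * k + 1)) * h1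
  rw [Nat.succ_eq_add_one, h2, coeff_C_mul] at key
  rw [Nat.succ_eq_add_one, Nat.add_sub_cancel_left]
  exact (mul_left_cancel₀ hi' key).symm

end PowerSeriesInversion

/-! ### Gleason's theorem for MacWilliams-invariant polynomials. -/

section Gleason

open Polynomial

/-- The value at `(x, t)` of the homogenization in degree `N` of the polynomial `p`. -/
def homogEval (N : ℕ) (p : ℚ[X]) (x t : ℚ) : ℚ :=
  ∑ j ∈ Finset.range (N + 1), p.coeff j * x ^ (N - j) * t ^ j

theorem homogEval_eq {N : ℕ} {p : ℚ[X]} (hp : p.natDegree ≤ N) {x : ℚ} (hx : x ≠ 0) (t : ℚ) :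
    homogEval N p x t = x ^ N * p.eval (t / x) := by
  rw [homogEval, eval_eq_sum_range' (Nat.lt_succ_of_le hp), Finset.mul_sum]
  refine Finset.sum_congr rfl fun j hj => ?_
  obtain ⟨k, rfl⟩ := Nat.exists_eq_add_of_le (Nat.lt_succ_iff.1 (Finset.mem_range.1 hj))
  rw [Nat.add_sub_cancel_left, div_pow, pow_add]
  field_simp

/-- Invariance of the homogenization in degree `N` of `p (t ^ 2)` under the MacWilliams
transform. -/
structure IsMacWilliamsInvariant (N : ℕ) (p : ℚ[X]) : Prop where
  natDegree_le : p.natDegree ≤ N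
  homogEval_eq : ∀ y : ℚ, y ≠ 0 → y ≠ 1 → y ≠ -1 →
    homogEval N p ((1 + y) ^ 2) ((1 - y) ^ 2) = 2 ^ N * p.eval (y ^ 2)

theorem IsMacWilliamsInvariant.sub_C_mul {N : ℕ} {p : ℚ[X]} (hp : IsMacWilliamsInvariant N p)
    (c : ℚ) : IsMacWilliamsInvariant N (p - C c * (1 + X) ^ N) := by
  have hd : (p - C c * (1 + X) ^ N).natDegree ≤ N := by
    refine (natDegree_sub_le _ _).trans (max_le hp.natDegree_le ?_)
    refine (natDegree_C_mul_le _ _).trans (natDegree_pow_le_of_le N ?_ |>.trans (by rw [mul_one]))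
    exact natDegree_add_le_of_degree_le (by simp) natDegree_X_le
  refine ⟨hd, fun y h0 h1 h2 => ?_⟩
  have hx : (1 + y) ^ 2 ≠ 0 := pow_ne_zero 2 fun h => h2 (by linarith)
  have h := hp.homogEval_eq y h0 h1 h2
  rw [_root_.homogEval_eq hp.natDegree_le hx] at h
  rw [_root_.homogEval_eq hd hx, eval_sub, eval_sub, mul_sub, mul_sub, h]
  simp only [eval_mul, eval_C, eval_pow, eval_add, eval_one, eval_X]
  have h3 : ((1 + y) ^ 2) ^ N * (1 + (1 - y) ^ 2 / (1 + y) ^ 2) ^ N = 2 ^ N * (1 + y ^ 2) ^ N := by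
    rw [← mul_pow, ← mul_pow, mul_add, mul_div_cancel₀ _ hx]; ring
  linear_combination -c * h3

/-- The division step of Gleason's theorem. If `p` vanishes at `0`, each term of its transform
contains `(1 - y) ^ 2`, so by invariance `p` has a double zero at `1`. The quotient is again
invariant because `x t (x - t) ^ 2` is an invariant form of degree 4 in the squares. -/
theorem IsMacWilliamsInvariant.dvd {N : ℕ} {p : ℚ[X]} (hp : IsMacWilliamsInvariant N p)
    (h0 : p.coeff 0 = 0) (hne : p ≠ 0) :
    4 ≤ N ∧ ∃ q, p = X * (1 - X) ^ 2 * q ∧ IsMacWilliamsInvariant (N - 4) q := by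
  set Q : ℚ[X] := ∑ j ∈ Finset.range (N + 1),
    C (p.coeff j) * ((1 + X) ^ 2) ^ (N - j) * ((1 - X) ^ 2) ^ j with hQ
  -- The excluded values of `y` are finitely many, so invariance is an identity of polynomials and
  -- may be used at `1` and `-1` after all.
  have hQp : Q = C (2 ^ N) * p.comp (X ^ 2) := by
    refine eq_of_infinite_eval_eq _ _ (Set.Infinite.mono (s := ({0, 1, -1} : Set ℚ)ᶜ) ?_
      (Set.toFinite _).infinite_compl)
    intro y hy
    simp only [Set.mem_compl_iff, Set.mem_insert_iff, Set.mem_singleton_iff, not_or] at hy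
    have := hp.homogEval_eq y hy.1 hy.2.1 hy.2.2
    simpa [hQ, eval_finsetSum, homogEval] using this
  have hQd : (1 - X) ^ 2 ∣ Q := by
    refine Finset.dvd_sum fun j _ => ?_
    rcases Nat.eq_zero_or_pos j with rfl | hj
    · simp [h0]
    · exact Dvd.dvd.mul_left (dvd_pow_self _ hj.ne') _
  obtain ⟨R, hR⟩ := hQd
  rw [hQp] at hR
  have h1 : p.eval 1 = 0 := by
    have := congrArg (eval 1) hR
    simpa using this
  have h1' : p.derivative.eval 1 = 0 := by
    have := congrArg (fun f => eval 1 (derivative f)) hR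
    simpa [derivative_comp, derivative_pow] using this
  -- At `y = -1` only the term `j = N` of the transform survives, and it is a multiple of `p(1) =
  -- 0`.
  have hpN : p.coeff N = 0 := by
    have := congrArg (eval (-1)) hQp
    rw [hQ, eval_finsetSum, Finset.sum_eq_single N] at this
    · simpa [h1] using this
    · intro j hj hjN
      have : N - j ≠ 0 := by have := Finset.mem_range.1 hj; omega
      simp [this]
    · intro h; exact absurd (Finset.mem_range.2 (Nat.lt_succ_self N)) h
  obtain ⟨s, hs⟩ := X_dvd_iff.2 h0
  have hs1 : s.IsRoot 1 := by simpa [hs] using h1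
  obtain ⟨r, hr⟩ := dvd_iff_isRoot.2 hs1
  have hr1 : r.IsRoot 1 := by simpa [hs, hr] using h1'
  obtain ⟨q, hq⟩ := dvd_iff_isRoot.2 hr1
  have hpq : p = X * (1 - X) ^ 2 * q := by
    rw [hs, hr, hq, C_1]; ring
  have hq0 : q ≠ 0 := by rintro rfl; exact hne (by rw [hpq, mul_zero])
  have hdeg : p.natDegree = 3 + q.natDegree := by
    rw [hs, hr, hq, natDegree_X_mul (by rw [← hq, ← hr]; rintro rfl; exact hne (by simp [hs])),
      natDegree_mul (X_sub_C_ne_zero 1) (mul_ne_zero (X_sub_C_ne_zero 1) hq0),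
      natDegree_mul (X_sub_C_ne_zero 1) hq0, natDegree_X_sub_C]
    ring
  -- The factor `X * (1 - X) ^ 2` has degree 3 only; strictness here supplies the missing unit in
  -- the drop from `N` to `N - 4`.
  have hlt : p.natDegree < N := by
    refine lt_of_le_of_ne hp.natDegree_le fun h => ?_
    rw [← h] at hpN
    exact hne (leadingCoeff_eq_zero.1 hpN)
  refine ⟨by omega, q, hpq, by omega, fun y hy0 hy1 hy2 => ?_⟩
  obtain ⟨M, rfl⟩ := Nat.exists_eq_add_of_le (show 4 ≤ N by omega)
  rw [Nat.add_sub_cancel_left]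
  have hy2' : 1 + y ≠ 0 := fun h => hy2 (by linarith)
  have hy1' : 1 - y ≠ 0 := fun h => hy1 (by linarith)
  have hx : (1 + y) ^ 2 ≠ 0 := pow_ne_zero 2 hy2'
  have h := hp.homogEval_eq y hy0 hy1 hy2
  rw [_root_.homogEval_eq hp.natDegree_le hx, hpq] at h
  rw [_root_.homogEval_eq (by omega) hx]
  simp only [eval_mul, eval_pow, eval_sub, eval_one, eval_X] at h
  have h2 : ((1 + y) ^ 2) ^ 4 * ((1 - y) ^ 2 / (1 + y) ^ 2 * (1 - (1 - y) ^ 2 / (1 + y) ^ 2) ^ 2)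
      = 2 ^ 4 * (y ^ 2 * (1 - y ^ 2) ^ 2) := by
    field_simp; ring
  have h3 : (2 : ℚ) ^ 4 * (y ^ 2 * (1 - y ^ 2) ^ 2) ≠ 0 := by
    have : 1 - y ^ 2 ≠ 0 := by
      rw [show 1 - y ^ 2 = (1 - y) * (1 + y) by ring]; exact mul_ne_zero hy1' hy2'
    positivity
  refine mul_left_cancel₀ h3 ?_
  rw [pow_add, pow_add] at h
  linear_combination h - (((1 + y) ^ 2) ^ M * q.eval ((1 - y) ^ 2 / (1 + y) ^ 2)) * h2

/-- Gleason's theorem for self-dual binary codes, in dehomogenized form. -/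
theorem IsMacWilliamsInvariant.exists_expansion {N : ℕ} {p : ℚ[X]}
    (hp : IsMacWilliamsInvariant N p) :
    ∃ a : ℕ → ℚ, p = ∑ j ∈ Finset.range (N / 4 + 1),
      C (a j) * ((1 + X) ^ (N - 4 * j) * (X * (1 - X) ^ 2) ^ j) := by
  induction N using Nat.strong_induction_on generalizing p with
  | _ N ih =>
    -- Removing the multiple of `(1 + X) ^ N` with the same constant term makes the remainder
    -- divisible by `X * (1 - X) ^ 2`, with invariant quotient in degree `N - 4`.
    have hp' := hp.sub_C_mul (p.coeff 0)
    set c := p.coeff 0 with hc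
    by_cases hz : p - C c * (1 + X) ^ N = 0
    · refine ⟨fun j => if j = 0 then c else 0, ?_⟩
      rw [Finset.sum_range_succ', Finset.sum_eq_zero]
      · simpa [sub_eq_zero] using hz
      · simp
    · obtain ⟨hN, q, hpq, hq⟩ := hp'.dvd (by simp [coeff_zero_eq_eval_zero, hc]) hz
      obtain ⟨b, hb⟩ := ih (N - 4) (by omega) hq
      refine ⟨fun j => Nat.casesOn j c b, ?_⟩
      have h4 : N / 4 = (N - 4) / 4 + 1 := by omega
      rw [Finset.sum_range_succ', h4]
      have : p = X * (1 - X) ^ 2 * q + C c * (1 + X) ^ N := by rw [← hpq]; ring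
      rw [this, hb, Finset.mul_sum]
      simp only [mul_zero, Nat.sub_zero, pow_zero, mul_one]
      refine congrArg (· + C c * (1 + X) ^ N) (Finset.sum_congr rfl fun j _ => ?_)
      rw [show N - 4 * (j + 1) = N - 4 - 4 * j by omega]
      ring

/-- The transform that yields the weight enumerator of the shadow, applied to an expansion in
Gleason's polynomials. -/
theorem homogEval_shadow_eq {N : ℕ} {p : ℚ[X]} (hd : p.natDegree ≤ N) (a : ℕ → ℚ)
    (hp : p = ∑ j ∈ Finset.range (N / 4 + 1),
      C (a j) * ((1 + X) ^ (N - 4 * j) * (X * (1 - X) ^ 2) ^ j)) {y : ℚ} (hy : y ≠ -1) :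
    homogEval N p ((1 + y) ^ 2) (-(1 - y) ^ 2) = ∑ j ∈ Finset.range (N / 4 + 1),
      a j * (4 * y) ^ (N - 4 * j) * (-4) ^ j * (1 - y ^ 4) ^ (2 * j) := by
  have hy' : 1 + y ≠ 0 := fun h => hy (by linarith)
  have hx : (1 + y) ^ 2 ≠ 0 := pow_ne_zero 2 hy'
  rw [homogEval_eq hd hx, hp, eval_finsetSum, Finset.mul_sum]
  refine Finset.sum_congr rfl fun j hj => ?_
  have hj' : 4 * j ≤ N := by have := Finset.mem_range.1 hj; omega
  obtain ⟨k, rfl⟩ := Nat.exists_eq_add_of_le hj'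
  simp only [eval_mul, eval_pow, eval_sub, eval_add, eval_one, eval_X, eval_C]
  rw [Nat.add_sub_cancel_left]
  -- At `x = (1 + y) ^ 2`, `t = -(1 - y) ^ 2`, the two Gleason forms `x + t` and `x t (x - t) ^ 2`
  -- become `4y` and `-4 (1 - y ^ 4) ^ 2`.
  have h1 : (1 + y) ^ 2 * (1 + -(1 - y) ^ 2 / (1 + y) ^ 2) = 4 * y := by field_simp; ring
  have h2 : ((1 + y) ^ 2) ^ 4 * (-(1 - y) ^ 2 / (1 + y) ^ 2 *
      (1 - -(1 - y) ^ 2 / (1 + y) ^ 2) ^ 2) = -4 * (1 - y ^ 4) ^ 2 := by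
    field_simp; ring
  rw [pow_mul _ 2, mul_assoc _ ((-4 : ℚ) ^ j), ← mul_pow (-4 : ℚ), ← h1, ← h2]
  generalize -(1 - y) ^ 2 / (1 + y) ^ 2 * (1 - -(1 - y) ^ 2 / (1 + y) ^ 2) ^ 2 = B
  generalize 1 + -(1 - y) ^ 2 / (1 + y) ^ 2 = A
  generalize (1 + y) ^ 2 = w
  ring

end Gleason

/-! ### MacWilliams identities for a self-dual code and its shadow. -/

section MacWilliams

variable {n : ℕ}

theorem hammingNorm_eq_sum_val (v : Fin n → ZMod 2) : hammingNorm v = ∑ i, (v i).val := by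
  rw [hammingNorm, Finset.card_filter]
  refine Finset.sum_congr rfl fun i _ => ?_
  generalize v i = a
  revert a; decide

theorem hammingNorm_le_length (v : Fin n → ZMod 2) : hammingNorm v ≤ n := by
  simpa using hammingNorm_le_card_fintype (x := v)

theorem hammingNorm_add_add_two_mul (a b : Fin n → ZMod 2) :
    hammingNorm (a + b) + 2 * ∑ i, (a i).val * (b i).val = hammingNorm a + hammingNorm b := by
  simp_rw [hammingNorm_eq_sum_val, Finset.mul_sum]
  rw [← Finset.sum_add_distrib, ← Finset.sum_add_distrib]
  refine Finset.sum_congr rfl fun i _ => ?_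
  rw [Pi.add_apply]
  generalize a i = x
  generalize b i = y
  revert x y; decide

theorem add_self_binary (v : Fin n → ZMod 2) : v + v = 0 := by
  ext i
  exact CharTwo.add_self_eq_zero (v i)

/-- The nontrivial additive character of `F_2`. -/
def signChar : AddChar (ZMod 2) ℚ where
  toFun a := if a = 0 then 1 else -1
  map_zero_eq_one' := by simp
  map_add_eq_mul' := by
    intro a b
    have h : ∀ a b : ZMod 2, a + b = 0 ↔ (a = 0 ↔ b = 0) := by decide
    simp only [h]
    by_cases ha : a = 0 <;> by_cases hb : b = 0 <;> simp [ha, hb]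

theorem signChar_apply (a : ZMod 2) : signChar a = if a = 0 then 1 else -1 := rfl

theorem signChar_eq_one_iff (a : ZMod 2) : signChar a = 1 ↔ a = 0 := by
  rw [signChar_apply]
  split_ifs with h
  · simp [h]
  · simp only [h, iff_false]; norm_num

theorem signChar_sum {ι : Type*} (s : Finset ι) (f : ι → ZMod 2) :
    signChar (∑ i ∈ s, f i) = ∏ i ∈ s, signChar (f i) := by
  classical
  induction s using Finset.induction_on with
  | empty => simp
  | insert i s hi ih => rw [Finset.sum_insert hi, Finset.prod_insert hi, AddChar.map_add_eq_mul, ih]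

/-- The monomial of a vector in the homogeneous weight enumerator. -/
def weightMonomial (x y : ℚ) (v : Fin n → ZMod 2) : ℚ :=
  x ^ (n - hammingNorm v) * y ^ hammingNorm v

theorem weightMonomial_eq_prod (x y : ℚ) (v : Fin n → ZMod 2) :
    weightMonomial x y v = ∏ i, if v i = 0 then x else y := by
  rw [Finset.prod_ite, Finset.prod_const, Finset.prod_const, weightMonomial]
  congr 2
  have := Finset.card_filter_add_card_filter_not (s := (Finset.univ : Finset (Fin n)))
    (fun i => v i = 0)
  rw [Finset.card_univ, Fintype.card_fin] at this
  rw [hammingNorm, ← Nat.sub_eq_of_eq_add this.symm]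

theorem sum_signChar_mul_weightMonomial (x y : ℚ) (c : Fin n → ZMod 2) :
    ∑ v : Fin n → ZMod 2, signChar (∑ i, v i * c i) * weightMonomial x y v =
      weightMonomial (x + y) (x - y) c := by
  simp_rw [signChar_sum, weightMonomial_eq_prod, ← Finset.prod_mul_distrib]
  have h := Finset.prod_univ_sum (fun _ : Fin n => (Finset.univ : Finset (ZMod 2)))
    (fun i a => signChar (a * c i) * if a = 0 then x else y)
  rw [Fintype.piFinset_univ] at h
  rw [← h]
  refine Finset.prod_congr rfl fun i _ => ?_
  have h2 : ∀ f : ZMod 2 → ℚ, ∑ a, f a = f 0 + f 1 := fun f => Fin.sum_univ_two f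
  rw [h2, signChar_apply, signChar_apply]
  split_ifs
  all_goals first | (simp_all; done) | (simp_all; ring)

/-- The elements of a set of binary vectors as a finset. -/
noncomputable def vectorFinset (S : Set (Fin n → ZMod 2)) : Finset (Fin n → ZMod 2) :=
  S.toFinite.toFinset

@[simp] theorem mem_vectorFinset {S : Set (Fin n → ZMod 2)} {v : Fin n → ZMod 2} :
    v ∈ vectorFinset S ↔ v ∈ S := Set.Finite.mem_toFinset _

open Classical in
theorem sum_mul_character (C : BinaryCode n) (χ : (Fin n → ZMod 2) → ℚ)
    (hχ : ∀ a ∈ C, ∀ b ∈ C, χ (a + b) = χ a * χ b) :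
    ∑ c ∈ vectorFinset (C : Set (Fin n → ZMod 2)), χ c =
      if ∀ c ∈ C, χ c = 1 then ((vectorFinset (C : Set (Fin n → ZMod 2))).card : ℚ) else 0 := by
  split_ifs with h
  · rw [Finset.sum_congr rfl fun c hc => h c (mem_vectorFinset.1 hc)]
    simp
  · push Not at h
    obtain ⟨c₀, hc₀, h1⟩ := h
    -- Translation by `c₀` permutes the code and multiplies the sum by `χ c₀ ≠ 1`.
    have h2 : ∑ c ∈ vectorFinset (C : Set (Fin n → ZMod 2)), χ c =
        χ c₀ * ∑ c ∈ vectorFinset (C : Set (Fin n → ZMod 2)), χ c := by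
      rw [Finset.mul_sum]
      refine Finset.sum_bij' (fun c _ => c₀ + c) (fun c _ => c₀ + c) ?_ ?_ ?_ ?_ ?_
      · intro c hc; exact mem_vectorFinset.2 (C.add_mem hc₀ (mem_vectorFinset.1 hc))
      · intro c hc; exact mem_vectorFinset.2 (C.add_mem hc₀ (mem_vectorFinset.1 hc))
      · intro c _; rw [← add_assoc, add_self_binary, zero_add]
      · intro c _; rw [← add_assoc, add_self_binary, zero_add]
      · intro c hc
        have h3 := hχ c₀ hc₀ _ (C.add_mem hc₀ (mem_vectorFinset.1 hc))
        rwa [← add_assoc, add_self_binary, zero_add] at h3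
    have h3 : (1 - χ c₀) * ∑ c ∈ vectorFinset (C : Set (Fin n → ZMod 2)), χ c = 0 := by
      linear_combination h2
    exact (mul_eq_zero.1 h3).resolve_left (sub_ne_zero.2 (Ne.symm h1))

/-- The MacWilliams identity, twisted by a real character `χ` of the code. -/
theorem macWilliams_twisted (C : BinaryCode n) (χ : (Fin n → ZMod 2) → ℚ)
    (hχ : ∀ a ∈ C, ∀ b ∈ C, χ (a + b) = χ a * χ b) (x y : ℚ) :
    ∑ c ∈ vectorFinset (C : Set (Fin n → ZMod 2)), χ c * weightMonomial (x + y) (x - y) c =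
      (vectorFinset (C : Set (Fin n → ZMod 2))).card *
        ∑ v ∈ vectorFinset {v | ∀ c ∈ C, χ c * signChar (∑ i, v i * c i) = 1},
          weightMonomial x y v := by
  classical
  simp_rw [← sum_signChar_mul_weightMonomial, Finset.mul_sum]
  rw [Finset.sum_comm]
  -- For fixed `v` the sum over the code is that of a real character, hence `|C|` or `0`.
  have h : ∀ v : Fin n → ZMod 2, ∑ c ∈ vectorFinset (C : Set (Fin n → ZMod 2)),
      χ c * (signChar (∑ i, v i * c i) * weightMonomial x y v) =
      if ∀ c ∈ C, χ c * signChar (∑ i, v i * c i) = 1 then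
        (vectorFinset (C : Set (Fin n → ZMod 2))).card * weightMonomial x y v else 0 := by
    intro v
    simp_rw [← mul_assoc]
    rw [← Finset.sum_mul, sum_mul_character C fun c => χ c * signChar (∑ i, v i * c i)]
    · split_ifs <;> simp
    · intro a ha b hb
      simp only [Pi.add_apply, mul_add, Finset.sum_add_distrib, AddChar.map_add_eq_mul,
        hχ a ha b hb]
      ring
  simp_rw [h]
  rw [← Finset.sum_filter]
  refine Finset.sum_congr ?_ fun _ _ => rfl
  ext v; simp

theorem dualCode_eq_setOf (C : BinaryCode n) :
    {v : Fin n → ZMod 2 | ∀ c ∈ C, (1 : ℚ) * signChar (∑ i, v i * c i) = 1} =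
      dualCode (C : Set (Fin n → ZMod 2)) := by
  ext v
  simp only [one_mul, signChar_eq_one_iff]
  rfl

theorem IsSelfDualCode.sum_mul_eq_zero {C : BinaryCode n} (hC : IsSelfDualCode C)
    {a b : Fin n → ZMod 2} (ha : a ∈ C) (hb : b ∈ C) : ∑ i, a i * b i = 0 := by
  rw [← hC] at ha
  exact ha b hb

theorem IsSelfDualCode.mem_of_forall {C : BinaryCode n} (hC : IsSelfDualCode C)
    {v : Fin n → ZMod 2} (h : ∀ c ∈ C, ∑ i, v i * c i = 0) : v ∈ C := by
  rw [← hC]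
  exact h

theorem IsSelfDualCode.macWilliams {C : BinaryCode n} (hC : IsSelfDualCode C) (x y : ℚ) :
    ∑ c ∈ vectorFinset (C : Set (Fin n → ZMod 2)), weightMonomial (x + y) (x - y) c =
      (vectorFinset (C : Set (Fin n → ZMod 2))).card *
        ∑ c ∈ vectorFinset (C : Set (Fin n → ZMod 2)), weightMonomial x y c := by
  have h := macWilliams_twisted C (fun _ => 1) (by simp) x y
  rw [dualCode_eq_setOf, hC] at h
  simpa using h

theorem IsSelfDualCode.card {C : BinaryCode n} (hC : IsSelfDualCode C) {N : ℕ} (hn : n = 2 * N) :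
    ((vectorFinset (C : Set (Fin n → ZMod 2))).card : ℚ) = 2 ^ N := by
  -- At `x = y = 1` the left side keeps only the zero codeword, which gives `2 ^ n = |C| ^ 2`.
  have h := hC.macWilliams 1 1
  rw [Finset.sum_eq_single 0] at h
  · have h2 : ((2 : ℚ) ^ N) ^ 2 = ((vectorFinset (C : Set (Fin n → ZMod 2))).card : ℚ) ^ 2 := by
      simp only [weightMonomial, hammingNorm_zero, Nat.sub_zero, pow_zero, mul_one, one_pow,
        Finset.sum_const, nsmul_eq_mul] at h
      rw [← pow_mul, mul_comm N, ← hn]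
      norm_num at h
      rw [h]; ring
    exact (pow_left_inj₀ (by positivity) (by positivity) two_ne_zero).1 h2.symm
  · intro c _ hc
    have : hammingNorm c ≠ 0 := hammingNorm_ne_zero_iff.2 hc
    simp [weightMonomial, this]
  · intro h; exact absurd (mem_vectorFinset.2 C.zero_mem) h

/-- The sign `(-1) ^ (wt c / 2)`. -/
def halfWeightSign (c : Fin n → ZMod 2) : ℚ := (-1) ^ (hammingNorm c / 2)

/-- Self-orthogonality makes the overlap of `a` and `b` even, so `wt (a + b)` agrees with `wt a + wt
b` modulo 4. -/
theorem halfWeightSign_add {C : BinaryCode n} (hC : IsSelfDualCode C)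
    (he : ∀ c ∈ C, 2 ∣ hammingNorm c) {a b : Fin n → ZMod 2} (ha : a ∈ C) (hb : b ∈ C) :
    halfWeightSign (a + b) = halfWeightSign a * halfWeightSign b := by
  obtain ⟨α, hα⟩ := he a ha
  obtain ⟨β, hβ⟩ := he b hb
  obtain ⟨γ, hγ⟩ := he _ (C.add_mem ha hb)
  have h := hammingNorm_add_add_two_mul a b
  have hk : ((∑ i, (a i).val * (b i).val : ℕ) : ZMod 2) = 0 := by
    rw [← hC.sum_mul_eq_zero ha hb]
    push_cast
    simp
  obtain ⟨k, hk⟩ := (ZMod.natCast_eq_zero_iff _ 2).1 hk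
  rw [hk, hα, hβ, hγ] at h
  rw [halfWeightSign, halfWeightSign, halfWeightSign, hα, hβ, hγ, ← pow_add]
  have h2 : 2 * α / 2 + 2 * β / 2 = 2 * γ / 2 + 2 * k := by omega
  rw [h2, pow_add, pow_mul]
  simp

theorem halfWeightSign_eq_one_iff {c : Fin n → ZMod 2} (he : 2 ∣ hammingNorm c) :
    halfWeightSign c = 1 ↔ 4 ∣ hammingNorm c := by
  obtain ⟨k, hk⟩ := he
  rw [halfWeightSign, hk, Nat.mul_div_cancel_left _ two_pos]
  rcases Nat.even_or_odd k with h | h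
  · rw [h.neg_one_pow]
    obtain ⟨l, rfl⟩ := h
    exact ⟨fun _ => ⟨l, by ring⟩, fun _ => rfl⟩
  · rw [h.neg_one_pow]
    obtain ⟨l, rfl⟩ := h
    exact ⟨fun h => by norm_num at h, fun h => by omega⟩

theorem halfWeightSign_eq (c : Fin n → ZMod 2) : halfWeightSign c = 1 ∨ halfWeightSign c = -1 :=
  neg_one_pow_eq_or ℚ _

/-- A vector orthogonal to the doubly-even part but outside `C = C^⊥` pairs to 1 with some codeword
`d`. As `d` lies outside the doubly-even part, adding it moves every other such codeword into that
part. Hence pairing with the vector is exactly the character `halfWeightSign`, and the twisted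
MacWilliams identity applies to the shadow. -/
theorem shadow_eq_setOf {C : BinaryCode n} (hC : IsSelfDualCode C) (hs : IsSinglyEven C) :
    shadow C = {v | ∀ c ∈ C, halfWeightSign c * signChar (∑ i, v i * c i) = 1} := by
  ext v
  constructor
  · rintro ⟨hv, hvC⟩ c hc
    have hv' : ∀ c ∈ C, halfWeightSign c = 1 → ∑ i, v i * c i = 0 := fun c hc h =>
      hv c ⟨hc, (halfWeightSign_eq_one_iff (hs.1 c hc)).1 h⟩
    rcases halfWeightSign_eq c with h | h
    · rw [h, hv' c hc h]; simp
    · obtain ⟨d, hd, hvd⟩ : ∃ d ∈ C, ∑ i, v i * d i ≠ 0 := by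
        by_contra! hall
        exact hvC (hC.mem_of_forall hall)
      have hd1 : halfWeightSign d = -1 :=
        (halfWeightSign_eq d).resolve_left fun h => hvd (hv' d hd h)
      have hcd := hv' (c + d) (C.add_mem hc hd)
        (by rw [halfWeightSign_add hC hs.1 hc hd, h, hd1]; norm_num)
      simp only [Pi.add_apply, mul_add, Finset.sum_add_distrib] at hcd
      have : ∑ i, v i * c i ≠ 0 := fun h0 => hvd (by rw [h0, zero_add] at hcd; exact hcd)
      rw [h, signChar_apply, if_neg this]; norm_num
  · intro h
    refine ⟨fun c hc => ?_, fun hvC => ?_⟩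
    · have h1 := h c hc.1
      rw [(halfWeightSign_eq_one_iff (hs.1 c hc.1)).2 hc.2, one_mul, signChar_eq_one_iff] at h1
      exact h1
    · obtain ⟨c, hc, hc4⟩ := hs.2
      have h1 := h c hc
      rw [hC.sum_mul_eq_zero hvC hc, AddChar.map_zero_eq_one, mul_one,
        halfWeightSign_eq_one_iff (hs.1 c hc)] at h1
      exact hc4 h1

/-- Both vectors induce the same character on `C`, so their sum induces the trivial one. -/
theorem add_mem_of_mem_shadow {C : BinaryCode n} (hC : IsSelfDualCode C) (hs : IsSinglyEven C)
    {u v : Fin n → ZMod 2} (hu : u ∈ shadow C) (hv : v ∈ shadow C) : u + v ∈ C := by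
  rw [shadow_eq_setOf hC hs] at hu hv
  refine hC.mem_of_forall fun c hc => ?_
  rw [← signChar_eq_one_iff]
  simp only [Pi.add_apply, add_mul, Finset.sum_add_distrib, AddChar.map_add_eq_mul]
  have h1 := hu c hc
  have h2 := hv c hc
  rcases halfWeightSign_eq c with h | h <;> rw [h] at h1 h2
  · rw [one_mul] at h1 h2; rw [h1, h2, one_mul]
  · linear_combination (-1 : ℚ) * h1 * signChar (∑ i, v i * c i) + h2

/-- The sum of distinct shadow vectors is a nonzero codeword. -/
theorem le_hammingNorm_add_of_mem_shadow {C : BinaryCode n} (hC : IsSelfDualCode C)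
    (hs : IsSinglyEven C) {d : ℕ} (hd : HasMinDistance C d) {u v : Fin n → ZMod 2}
    (hu : u ∈ shadow C) (hv : v ∈ shadow C) (huv : u ≠ v) : d ≤ hammingNorm u + hammingNorm v := by
  have h0 : u + v ≠ 0 := fun h => huv (by
    have : u + v + v = v := by rw [h, zero_add]
    rwa [add_assoc, add_self_binary, add_zero] at this)
  have h1 := hd.2 ⟨u + v, add_mem_of_mem_shadow hC hs hu hv, h0, rfl⟩
  have h2 := hammingNorm_add_add_two_mul u v
  omega

open Polynomial

/-- The weight enumerator of an even code in the variable `y ^ 2`. -/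
noncomputable def halfWeightEnumerator (C : BinaryCode n) : ℚ[X] :=
  ∑ c ∈ vectorFinset (C : Set (Fin n → ZMod 2)), X ^ (hammingNorm c / 2)

theorem natDegree_halfWeightEnumerator_le (C : BinaryCode n) {N : ℕ} (hn : n = 2 * N) :
    (halfWeightEnumerator C).natDegree ≤ N := by
  refine natDegree_sum_le_of_forall_le _ _ fun c _ => ?_
  rw [natDegree_X_pow]
  have := hammingNorm_le_length c
  omega

theorem homogEval_halfWeightEnumerator (C : BinaryCode n) {N : ℕ} (hn : n = 2 * N) (x t : ℚ) :
    homogEval N (halfWeightEnumerator C) x t =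
      ∑ c ∈ vectorFinset (C : Set (Fin n → ZMod 2)), x ^ (N - hammingNorm c / 2) * t ^ (hammingNorm c / 2) := by
  simp only [homogEval, halfWeightEnumerator, finsetSum_coeff, coeff_X_pow, Finset.sum_mul]
  rw [Finset.sum_comm]
  refine Finset.sum_congr rfl fun c _ => ?_
  rw [Finset.sum_eq_single (hammingNorm c / 2)]
  · simp
  · intro j _ hj; simp [hj]
  · intro h
    have := hammingNorm_le_length c
    exact absurd (Finset.mem_range.2 (by omega)) h

theorem sq_pow_mul_sq_pow {N : ℕ} (hn : n = 2 * N) {c : Fin n → ZMod 2} (he : 2 ∣ hammingNorm c)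
    (x y : ℚ) : (x ^ 2) ^ (N - hammingNorm c / 2) * (y ^ 2) ^ (hammingNorm c / 2) =
      weightMonomial x y c := by
  have := hammingNorm_le_length c
  rw [weightMonomial, ← pow_mul, ← pow_mul]
  congr 2 <;> omega

theorem isMacWilliamsInvariant_halfWeightEnumerator {C : BinaryCode n} (hC : IsSelfDualCode C)
    (he : ∀ c ∈ C, 2 ∣ hammingNorm c) {N : ℕ} (hn : n = 2 * N) :
    IsMacWilliamsInvariant N (halfWeightEnumerator C) := by
  refine ⟨natDegree_halfWeightEnumerator_le C hn, fun y _ _ _ => ?_⟩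
  have h1 : (halfWeightEnumerator C).eval (y ^ 2) = ∑ c ∈ vectorFinset (C : Set (Fin n → ZMod 2)), weightMonomial 1 y c := by
    rw [halfWeightEnumerator, eval_finsetSum]
    refine Finset.sum_congr rfl fun c hc => ?_
    rw [← sq_pow_mul_sq_pow hn (he c (mem_vectorFinset.1 hc))]
    simp
  rw [homogEval_halfWeightEnumerator C hn, h1, ← hC.card hn, ← hC.macWilliams]
  exact Finset.sum_congr rfl fun c hc => sq_pow_mul_sq_pow hn (he c (mem_vectorFinset.1 hc)) _ _

/-- The minus sign in the second argument inserts `halfWeightSign` into the sum over `C`. -/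
theorem homogEval_eq_sum_shadow {C : BinaryCode n} (hC : IsSelfDualCode C) (hs : IsSinglyEven C)
    {N : ℕ} (hn : n = 2 * N) (y : ℚ) :
    homogEval N (halfWeightEnumerator C) ((1 + y) ^ 2) (-(1 - y) ^ 2) =
      2 ^ N * ∑ v ∈ vectorFinset (shadow C), y ^ hammingNorm v := by
  have h := macWilliams_twisted C halfWeightSign (fun a ha b hb => halfWeightSign_add hC hs.1 ha hb)
    1 y
  rw [← shadow_eq_setOf hC hs, hC.card hn] at h
  simp only [weightMonomial, one_pow, one_mul] at h
  rw [← h, homogEval_halfWeightEnumerator C hn]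
  refine Finset.sum_congr rfl fun c hc => ?_
  have h2 := sq_pow_mul_sq_pow hn (hs.1 c (mem_vectorFinset.1 hc)) (1 + y) (1 - y)
  rw [weightMonomial] at h2
  rw [← h2, neg_pow, halfWeightSign]
  ring

theorem shadowCoeff_eq_coeff (C : BinaryCode n) (j : ℕ) : (shadowCoeff C j : ℚ) =
    (∑ v ∈ vectorFinset (shadow C), (X : ℚ[X]) ^ hammingNorm v).coeff (4 * j + n % 8 / 2) := by
  simp only [finsetSum_coeff, coeff_X_pow]
  rw [← Finset.sum_filter, Finset.sum_const, shadowCoeff, nsmul_eq_mul, mul_one,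
    ← Set.ncard_coe_finset]
  congr 2
  ext v
  simp [eq_comm]

/-- Gleason's theorem for a singly-even self-dual code and the resulting expansion of the weight
enumerator of the shadow. -/
theorem exists_gleason_expansion {D : BinaryCode n} (hD : IsSelfDualCode D) (hs : IsSinglyEven D)
    {N : ℕ} (hn : n = 2 * N) : ∃ a : ℕ → ℚ,
      halfWeightEnumerator D = ∑ j ∈ Finset.range (N / 4 + 1),
        C (a j) * ((1 + X) ^ (N - 4 * j) * (X * (1 - X) ^ 2) ^ j) ∧
      ∀ i, (shadowCoeff D i : ℚ) = (∑ j ∈ Finset.range (N / 4 + 1),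
        C (a j * 4 ^ (N - 4 * j) * (-4) ^ j / 2 ^ N) *
          (X ^ (N / 4 - j) * (1 - X) ^ (2 * j))).coeff i := by
  obtain ⟨a, ha⟩ := (isMacWilliamsInvariant_halfWeightEnumerator hD hs.1 hn).exists_expansion
  refine ⟨a, ha, fun i => ?_⟩
  set B : ℚ[X] := ∑ j ∈ Finset.range (N / 4 + 1), C (a j * 4 ^ (N - 4 * j) * (-4) ^ j / 2 ^ N) *
    (X ^ (N / 4 - j) * (1 - X) ^ (2 * j)) with hB
  -- In particular all shadow weights are congruent to `N` modulo 4. Only `y = -1` has to be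
  -- avoided.
  have h : ∑ v ∈ vectorFinset (shadow D), (X : ℚ[X]) ^ hammingNorm v
      = X ^ (N % 4) * expand ℚ 4 B := by
    refine eq_of_infinite_eval_eq _ _ (Set.Infinite.mono (s := ({-1} : Set ℚ)ᶜ) ?_
      (Set.toFinite _).infinite_compl)
    intro y hy
    have h1 := homogEval_eq_sum_shadow hD hs hn y
    rw [homogEval_shadow_eq (natDegree_halfWeightEnumerator_le D hn) a ha hy] at h1
    have h2 : (2 : ℚ) ^ N ≠ 0 := by positivity
    refine mul_left_cancel₀ h2 ?_
    simp only [eval_finsetSum, eval_mul, eval_pow, eval_X, expand_eval, hB, eval_C, eval_sub,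
      eval_one]
    rw [← h1, Finset.mul_sum, Finset.mul_sum]
    refine Finset.sum_congr rfl fun j hj => ?_
    have hj' := Finset.mem_range.1 hj
    have h3 : y ^ (N - 4 * j) = y ^ (N % 4) * (y ^ 4) ^ (N / 4 - j) := by
      rw [← pow_mul, ← pow_add]; congr 1; omega
    rw [mul_pow, h3]
    field_simp
  rw [shadowCoeff_eq_coeff, h, show n % 8 / 2 = N % 4 by omega, coeff_X_pow_mul, mul_comm 4 i,
    coeff_expand_mul (by norm_num)]

end MacWilliams

/-! ### Binomial formulas for power series coefficients. -/

section Coefficients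

open PowerSeries

theorem coeff_one_mul_eq (f g : ℚ⟦X⟧) :
    coeff 1 (f * g) = coeff 0 f * coeff 1 g + coeff 1 f * coeff 0 g := by
  rw [coeff_mul, Finset.Nat.sum_antidiagonal_eq_sum_range_succ_mk, Finset.sum_range_succ,
    Finset.sum_range_one]

theorem coeff_one_sub_X_inv_pow (d k : ℕ) :
    coeff k ((1 - X : ℚ⟦X⟧)⁻¹ ^ (d + 1)) = (d + k).choose d := by
  have h1 : (mk fun n => ((d + n).choose d : ℚ)) * (1 - X) ^ (d + 1) = 1 :=
    mk_add_choose_mul_one_sub_pow_eq_one ℚ d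
  have h2 : (1 - X : ℚ⟦X⟧) ^ (d + 1) * (1 - X)⁻¹ ^ (d + 1) = 1 := by
    rw [← mul_pow, one_sub_X_mul_inv, one_pow]
  rw [← left_inv_eq_right_inv h1 h2, coeff_mk]

theorem coeff_inv_pow_mul_inv_pow (d k : ℕ) :
    coeff k (((1 + X : ℚ⟦X⟧)⁻¹ * (1 - X)⁻¹) ^ (d + 1)) =
      if 2 ∣ k then ((d + k / 2).choose d : ℚ) else 0 := by
  have h1 : (mk fun n => ((d + n).choose d : ℚ)) * (1 - X) ^ (d + 1) = 1 :=
    mk_add_choose_mul_one_sub_pow_eq_one ℚ d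
  have h2 := congrArg (expand 2 two_ne_zero) h1
  simp only [map_mul, map_pow, map_sub, map_one, expand_X] at h2
  have h3 : (1 - X ^ 2 : ℚ⟦X⟧) ^ (d + 1) * ((1 + X)⁻¹ * (1 - X)⁻¹) ^ (d + 1) = 1 := by
    rw [← mul_pow, show (1 - X ^ 2 : ℚ⟦X⟧) * ((1 + X)⁻¹ * (1 - X)⁻¹) =
      ((1 + X) * (1 + X)⁻¹) * ((1 - X) * (1 - X)⁻¹) by ring, one_add_X_mul_inv, one_sub_X_mul_inv]
    simp
  rw [← left_inv_eq_right_inv h2 h3, coeff_expand]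
  simp

/-- The coefficient of `X ^ (2 * (m - q))` in `(1 - X ^ 2) ^ (-(d + 1))`. -/
def evenCoeff (d m q : ℕ) : ℚ := if q ≤ m then ((d + (m - q)).choose d : ℚ) else 0

theorem coeff_X_pow_even_mul (d m q : ℕ) :
    coeff (2 * m) (X ^ (2 * q) * ((1 + X : ℚ⟦X⟧)⁻¹ * (1 - X)⁻¹) ^ (d + 1)) = evenCoeff d m q := by
  rw [coeff_X_pow_mul', coeff_inv_pow_mul_inv_pow, evenCoeff]
  by_cases h : q ≤ m
  · rw [if_pos (by omega), if_pos (by omega), if_pos h]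
    congr 3; omega
  · rw [if_neg (by omega), if_neg h]

theorem coeff_X_pow_odd_mul (d m q : ℕ) :
    coeff (2 * m) (X ^ (2 * q + 1) * ((1 + X : ℚ⟦X⟧)⁻¹ * (1 - X)⁻¹) ^ (d + 1)) = 0 := by
  rw [coeff_X_pow_mul', coeff_inv_pow_mul_inv_pow]
  split_ifs
  · omega
  · rfl
  · rfl

theorem evenCoeff_zero (d m : ℕ) : evenCoeff d m 0 = (d + m).choose d := by
  simp [evenCoeff]

/-- The convention that `evenCoeff` vanishes for `q > m` keeps the recurrence valid for every `q`,
so small `m` need no separate treatment. -/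
theorem evenCoeff_succ (d m q : ℕ) :
    evenCoeff d m (q + 1) * (d + m - q) = evenCoeff d m q * (m - q) := by
  rw [evenCoeff, evenCoeff]
  rcases lt_trichotomy q m with h | rfl | h
  · rw [if_pos (by omega), if_pos (by omega)]
    obtain ⟨k, rfl⟩ := Nat.exists_eq_add_of_lt h
    have h1 := Nat.choose_mul_succ_eq (d + k) d
    rw [show q + k + 1 - (q + 1) = k by omega, show q + k + 1 - q = k + 1 by omega, ← add_assoc]
    rw [show d + k + 1 - d = k + 1 by omega] at h1
    have h2 : ((d + k).choose d : ℚ) * (d + k + 1) = (d + k + 1).choose d * (k + 1) := by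
      exact_mod_cast h1
    push_cast
    linear_combination h2
  · simp
  · rw [if_neg (by omega), if_neg (by omega)]; simp

/-- The coefficient of `X ^ q` in `(1 + X) * (1 - X) ^ (-(d + 1))`. -/
theorem coeff_one_add_X_mul {d : ℕ} (hd : 0 < d) (q : ℕ) :
    coeff q ((1 + X : ℚ⟦X⟧) * (1 - X : ℚ⟦X⟧)⁻¹ ^ (d + 1)) =
      (d + q).choose q * (d + 2 * q) / (d + q) := by
  obtain ⟨d, rfl⟩ := Nat.exists_eq_succ_of_ne_zero hd.ne'
  -- Write `1 + X = 2 - (1 - X)`.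
  have h : (1 + X : ℚ⟦X⟧) * (1 - X : ℚ⟦X⟧)⁻¹ ^ (d + 1 + 1) =
      (1 - X)⁻¹ ^ (d + 1 + 1) + (1 - X)⁻¹ ^ (d + 1 + 1) - (1 - X)⁻¹ ^ (d + 1) := by
    linear_combination (-(1 - X)⁻¹ ^ (d + 1) : ℚ⟦X⟧) * one_sub_X_mul_inv
  simp only [Nat.succ_eq_add_one]
  rw [h, map_sub, map_add, coeff_one_sub_X_inv_pow, coeff_one_sub_X_inv_pow]
  have h1 := Nat.add_one_mul_choose_eq (d + q) d
  rw [show d + q + 1 = d + 1 + q by omega] at h1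
  have h2 : (d + 1 + q : ℚ) * (d + q).choose d = (d + 1 + q).choose (d + 1) * (d + 1) := by
    exact_mod_cast h1
  rw [← Nat.choose_symm_add (a := d + 1) (b := q)]
  have h3 : (d + 1 + q : ℚ) ≠ 0 := by positivity
  push_cast
  field_simp
  linear_combination -h2

theorem cast_factorial_add (k a : ℕ) :
    ((k + a).factorial : ℚ) = k.factorial * ∏ i ∈ Finset.range a, ((k : ℚ) + i + 1) := by
  induction a with
  | zero => simp
  | succ a ih =>
    rw [Finset.prod_range_succ, ← add_assoc, Nat.factorial_succ]
    push_cast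
    rw [ih]; ring

/-- Brings binomials with shifted entries to the common factor `choose (k + m) m`, used with `k =
4m`. -/
theorem cast_choose_add_eq (k m a b : ℕ) :
    ((k + a + (m + b)).choose (m + b) : ℚ) = (k + m).choose m *
      ((∏ i ∈ Finset.range (a + b), ((k : ℚ) + m + i + 1)) /
        ((∏ i ∈ Finset.range a, ((k : ℚ) + i + 1)) * ∏ i ∈ Finset.range b, ((m : ℚ) + i + 1))) := by
  rw [add_comm (k + a), add_comm k m, Nat.cast_add_choose ℚ, Nat.cast_add_choose ℚ,
    show m + b + (k + a) = m + k + (a + b) by ring, cast_factorial_add, cast_factorial_add m b,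
    cast_factorial_add k a]
  have h1 : ∏ i ∈ Finset.range a, ((k : ℚ) + i + 1) ≠ 0 :=
    Finset.prod_ne_zero_iff.2 fun i _ => by positivity
  have h2 : ∏ i ∈ Finset.range b, ((m : ℚ) + i + 1) ≠ 0 :=
    Finset.prod_ne_zero_iff.2 fun i _ => by positivity
  have h3 : (m.factorial : ℚ) ≠ 0 := by positivity
  have h4 : (k.factorial : ℚ) ≠ 0 := by positivity
  push_cast
  rw [add_comm (m : ℚ) k]
  field_simp

end Coefficients

/-! ### The first two undetermined shadow coefficients. -/

section ShadowCoefficients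

open PowerSeries

variable {n : ℕ}

theorem halfWeightEnumerator_eq_one_add {D : BinaryCode n} (he : ∀ c ∈ D, 2 ∣ hammingNorm c)
    {d i : ℕ} (hd : HasMinDistance D d) (hi : 2 * i < d) :
    ∃ h : ℚ⟦X⟧, (halfWeightEnumerator D : ℚ⟦X⟧) = 1 + X ^ (i + 1) * h := by
  have hdvd : (X : ℚ⟦X⟧) ^ (i + 1) ∣ (halfWeightEnumerator D : ℚ⟦X⟧) - 1 := by
    rw [X_pow_dvd_iff]
    intro k hk
    rw [map_sub, Polynomial.coeff_coe, halfWeightEnumerator, Polynomial.finsetSum_coeff,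
      Finset.sum_eq_single 0]
    · simp [Polynomial.coeff_one, coeff_one]
    · intro c hc hc0
      rw [Polynomial.coeff_X_pow, if_neg]
      rintro rfl
      have h1 := hd.2 ⟨c, mem_vectorFinset.1 hc, hc0, rfl⟩
      have h2 := he c (mem_vectorFinset.1 hc)
      omega
    · intro h; exact absurd (mem_vectorFinset.2 D.zero_mem) h
  obtain ⟨h, hh⟩ := hdvd
  exact ⟨h, by rw [← hh]; ring⟩

/-- Large minimum distance and a sparse shadow determine the first free coefficients of the shadow
weight enumerator. -/
theorem shadowCoeff_eq_of_sparse {D : BinaryCode n} (hD : IsSelfDualCode D) (hs : IsSinglyEven D)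
    {m s M ε : ℕ} (hn : n = 2 * (12 * m + s)) (hm : 1 ≤ m)
    (hs4 : 4 ≤ s) (hM : M + 1 = m + s / 4) (hM1 : 1 ≤ M)
    (hε : ε ≤ M) (hd : HasMinDistance D (4 * m + 4))
    (hb : ∀ j < M, shadowCoeff D j = if j = ε then 1 else 0) :
    (shadowCoeff D (M + 1) : ℚ) =
      -(2 ^ s * ((12 * m + s) / (2 * m) * coeff (2 * m)
        (X * ((1 + X)⁻¹ ^ (4 * m + s + 1) * (1 - X)⁻¹ ^ (4 * m)))))
      - coeff (M + 1 - ε) ((1 + X : ℚ⟦X⟧) * (1 - X : ℚ⟦X⟧)⁻¹ ^ (4 * m + 1))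
      + (4 * m + 2) * (coeff (M - ε) ((1 + X : ℚ⟦X⟧) * (1 - X : ℚ⟦X⟧)⁻¹ ^ (4 * m + 2 + 1))
        - 2 ^ s / 64 * ((12 * m + s) / (2 * m + 1) * coeff (2 * m)
          ((1 + X)⁻¹ ^ (4 * m + s - 3) * (1 - X)⁻¹ ^ (4 * m + 2)))) := by
  obtain ⟨a, ha, hB⟩ := exists_gleason_expansion hD hs hn
  -- The shadow expansion reverses indices: its `i`-th coefficient comes from `a (2m + 1 + M - i)`,
  -- so `M` and `M + 1` meet `2m + 1` and `2m`, the last two indices controlled by the minimum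
  -- distance.
  have hK : (12 * m + s) / 4 = 2 * m + 1 + M := by omega
  rw [hK] at ha hB
  have haP := congrArg (fun p : Polynomial ℚ => (p : ℚ⟦X⟧)) ha
  simp only [← Polynomial.coeToPowerSeries.ringHom_apply, map_sum, map_mul, map_pow, map_add,
    map_sub, map_one] at haP
  simp only [Polynomial.coeToPowerSeries.ringHom_apply, Polynomial.coe_X, Polynomial.coe_C] at haP
  have hα : ∀ i ≤ 2 * m + 1, (i : ℚ) * a i = - (12 * m + s : ℕ) *
      coeff i (X * ((1 + X)⁻¹ ^ (12 * m + s + 1 - 4 * i) * (1 - X)⁻¹ ^ (2 * i))) := by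
    intro i hi
    obtain ⟨h, hh⟩ := halfWeightEnumerator_eq_one_add hs.1 hd (i := i) (by omega)
    exact gleasonCoeff_eq (K := 2 * m + 1 + M) (by omega) (by omega) a h (haP.symm.trans hh)
  set B : ℚ⟦X⟧ := mk fun i => (shadowCoeff D i : ℚ) with hBdef
  have hB' : B = ((∑ j ∈ Finset.range (2 * m + 1 + M + 1),
        Polynomial.C (a j * 4 ^ (12 * m + s - 4 * j) * (-4) ^ j / 2 ^ (12 * m + s)) *
          (Polynomial.X ^ (2 * m + 1 + M - j) * (1 - Polynomial.X) ^ (2 * j)) : Polynomial ℚ) :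
            ℚ⟦X⟧) := by
    ext i
    rw [hBdef, coeff_mk, hB, Polynomial.coeff_coe]
  simp only [← Polynomial.coeToPowerSeries.ringHom_apply, map_sum, map_mul, map_pow,
    map_sub, map_one] at hB'
  simp only [Polynomial.coeToPowerSeries.ringHom_apply, Polynomial.coe_X, Polynomial.coe_C] at hB'
  rw [← Finset.sum_range_reflect] at hB'
  have hβ : ∀ i ≤ 2 * m + 1 + M, 0 < i → a (2 * m + 1 + M - i) *
      4 ^ (12 * m + s - 4 * (2 * m + 1 + M - i)) * (-4) ^ (2 * m + 1 + M - i) / 2 ^ (12 * m + s) =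
      coeff i (B * ((1 + X) * (1 - X)⁻¹ ^ (2 * (2 * m + 1 + M - i) + 1))) := by
    intro i hi hi0
    refine shadowExpansion_coeff_eq (K := 2 * m + 1 + M) hi hi0 (fun i => a (2 * m + 1 + M - i) *
      4 ^ (12 * m + s - 4 * (2 * m + 1 + M - i)) * (-4) ^ (2 * m + 1 + M - i) / 2 ^ (12 * m + s))
      B ?_
    rw [hB']
    refine Finset.sum_congr rfl fun j hj => ?_
    have hj' := Finset.mem_range.1 hj
    rw [show 2 * m + 1 + M + 1 - 1 - j = 2 * m + 1 + M - j by omega,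
      show 2 * m + 1 + M - (2 * m + 1 + M - j) = j by omega]
  have hpow1 : (4 : ℚ) ^ (12 * m + s - 4 * (2 * m + 1)) * (-4) ^ (2 * m + 1) / 2 ^ (12 * m + s)
      = -(2 ^ s / 64) := by
    obtain ⟨t, rfl⟩ := Nat.exists_eq_add_of_le hs4
    rw [show 12 * m + (4 + t) - 4 * (2 * m + 1) = 4 * m + t by omega,
      (Odd.neg_pow ⟨m, rfl⟩ (4 : ℚ)), show (4 : ℚ) = 2 ^ 2 by norm_num, ← pow_mul, ← pow_mul,
      div_eq_iff (by positivity)]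
    ring
  have hpow0 : (4 : ℚ) ^ (12 * m + s - 4 * (2 * m)) * (-4) ^ (2 * m) / 2 ^ (12 * m + s)
      = 2 ^ s := by
    rw [show 12 * m + s - 4 * (2 * m) = 4 * m + s by omega,
      (Even.neg_pow ⟨m, two_mul m⟩ (4 : ℚ)), show (4 : ℚ) = 2 ^ 2 by norm_num, ← pow_mul, ← pow_mul,
      div_eq_iff (by positivity)]
    ring
  have h1 := hβ M (by omega) (by omega)
  have h0 := hβ (M + 1) (by omega) (by omega)
  rw [Nat.add_sub_cancel, mul_assoc, mul_div_assoc, hpow1,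
    show 2 * (2 * m + 1) + 1 = 4 * m + 2 + 1 by ring] at h1
  rw [show 2 * m + 1 + M - (M + 1) = 2 * m by omega, mul_assoc, mul_div_assoc, hpow0,
    show 2 * (2 * m) + 1 = 4 * m + 1 by ring] at h0
  have hα1 := hα (2 * m + 1) le_rfl
  have hα0 := hα (2 * m) (by omega)
  rw [show 12 * m + s + 1 - 4 * (2 * m + 1) = 4 * m + s - 3 by omega, coeff_succ_X_mul,
    show 2 * (2 * m + 1) = 4 * m + 2 by ring] at hα1
  rw [show 12 * m + s + 1 - 4 * (2 * m) = 4 * m + s + 1 by omega,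
    show 2 * (2 * m) = 4 * m by ring] at hα0
  -- The correction term matters only when `ε = M`, as for length 32, where the vectors of minimal
  -- weight are not yet counted by `hb`.
  set R : ℚ⟦X⟧ := mk fun i => (shadowCoeff D (M + i) : ℚ) - if M + i = ε then 1 else 0 with hR
  have hBR : B = X ^ ε + X ^ M * R := by
    ext j
    rw [map_add, coeff_X_pow, coeff_X_pow_mul', hBdef, coeff_mk]
    split_ifs with h2 h3 h3
    · rw [hR, coeff_mk, Nat.add_sub_cancel' h3, if_pos h2]; ring
    · rw [hb j (by omega), if_pos h2]; simp
    · rw [hR, coeff_mk, Nat.add_sub_cancel' h3, if_neg h2]; ring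
    · rw [hb j (by omega), if_neg h2]; simp
  have hG0 : ∀ d : ℕ, coeff 0 ((1 + X : ℚ⟦X⟧) * (1 - X : ℚ⟦X⟧)⁻¹ ^ (d + 1)) = 1 := by
    intro d; simp
  have hG1 : coeff 1 ((1 + X : ℚ⟦X⟧) * (1 - X : ℚ⟦X⟧)⁻¹ ^ (4 * m + 1)) = 4 * m + 2 := by
    rw [coeff_one_add_X_mul (by omega), Nat.choose_one_right]
    push_cast
    field_simp
  have hR1 : coeff 1 R = shadowCoeff D (M + 1) := by
    rw [hR, coeff_mk, if_neg (by omega), sub_zero]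
  rw [hBR, add_mul, map_add, coeff_X_pow_mul', if_pos hε, mul_assoc (X ^ M), coeff_X_pow_mul',
    if_pos le_rfl, Nat.sub_self, coeff_mul _ R, Finset.Nat.antidiagonal_zero, Finset.sum_singleton,
    hG0 (4 * m + 2)] at h1
  rw [hBR, add_mul, map_add, coeff_X_pow_mul', if_pos (by omega), mul_assoc (X ^ M),
    coeff_X_pow_mul', if_pos (by omega), Nat.add_sub_cancel_left, coeff_one_mul_eq R] at h0
  rw [hG1, hR1, hG0 (4 * m)] at h0
  have hm0 : (m : ℚ) ≠ 0 := by positivity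
  push_cast at hα1 hα0
  rw [mul_comm, ← eq_div_iff (by positivity)] at hα1
  rw [mul_comm, ← eq_div_iff (by positivity)] at hα0
  rw [hα1] at h1
  rw [hα0] at h0
  -- `h1` determines the constant term of `R`, which enters `h0` with factor `4m + 2`; eliminating
  -- it leaves the coefficient of index `M + 1`.
  linear_combination (4 * m + 2 : ℚ) * h1 - h0

end ShadowCoefficients

/-! ### Sparsity of the shadow, and coefficients of even degree. -/

section Evaluation

variable {n : ℕ}

theorem shadowCoeff_eq_ite {D : BinaryCode n} (hD : IsSelfDualCode D) (hs : IsSinglyEven D)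
    {d w ε j : ℕ} (hd : HasMinDistance D d)
    (hw : IsLeast {w | ∃ v ∈ shadow D, hammingNorm v = w} w) (hε : w = 4 * ε + n % 8 / 2)
    (hj : 4 * j + n % 8 / 2 + w < d) :
    shadowCoeff D j = if j = ε then 1 else 0 := by
  obtain ⟨v, hv, hvw⟩ := hw.1
  -- Otherwise `u + v` would be a nonzero codeword of weight less than `d`.
  have huniq : ∀ u ∈ shadow D, hammingNorm u = 4 * j + n % 8 / 2 → u = v := by
    intro u hu huw
    by_contra huv
    have := le_hammingNorm_add_of_mem_shadow hD hs hd hu hv huv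
    omega
  split_ifs with h
  · rw [shadowCoeff, Set.ncard_eq_one]
    refine ⟨v, Set.eq_singleton_iff_unique_mem.2 ⟨⟨hv, by rw [hvw, hε, h]⟩, fun u hu => ?_⟩⟩
    exact huniq u hu.1 hu.2
  · rw [shadowCoeff, Set.ncard_eq_zero]
    refine Set.eq_empty_iff_forall_notMem.2 fun u hu => ?_
    have h1 := huniq u hu.1 hu.2
    have h2 := hu.2
    rw [h1] at h2
    omega

open PowerSeries

/-- Isolates a power of `1 - X ^ 2`, an even series, times a polynomial of fixed degree `b`. -/
theorem inv_pow_mul_inv_pow_eq (a b : ℕ) :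
    (1 + X : ℚ⟦X⟧)⁻¹ ^ (a + b) * (1 - X : ℚ⟦X⟧)⁻¹ ^ a =
      (1 - X) ^ b * ((1 + X : ℚ⟦X⟧)⁻¹ * (1 - X)⁻¹) ^ (a + b) := by
  have h : (1 - X : ℚ⟦X⟧) ^ b * (1 - X : ℚ⟦X⟧)⁻¹ ^ b = 1 := by
    rw [← mul_pow, one_sub_X_mul_inv, one_pow]
  rw [mul_pow, pow_add (1 - X : ℚ⟦X⟧)⁻¹]
  linear_combination (-(1 + X : ℚ⟦X⟧)⁻¹ ^ (a + b) * (1 - X : ℚ⟦X⟧)⁻¹ ^ a) * h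

theorem evenCoeff_succ_eq (d m q : ℕ) {z : ℚ} (hz : d + m - q = z)
    (hz0 : z ≠ 0) : evenCoeff d m (q + 1) = evenCoeff d m q * (m - q) / z := by
  rw [eq_div_iff hz0, ← hz, evenCoeff_succ]

/-- Against an even series, only the even-degree terms of `X * (1 - X) ^ 5` reach degree `2m`. The
variants below rest on the same parity. -/
theorem coeff_X_mul_one_sub_X_pow_5_mul (d m : ℕ) :
    coeff (2 * m) (X * ((1 - X) ^ 5 * ((1 + X : ℚ⟦X⟧)⁻¹ * (1 - X)⁻¹) ^ (d + 1))) =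
      -(5 * evenCoeff d m 1 + 10 * evenCoeff d m 2 + evenCoeff d m 3) := by
  have h : ∀ G : ℚ⟦X⟧, X * ((1 - X) ^ 5 * G) =
        C (1 : ℚ) * (X ^ (2 * 0 + 1) * G) + C (-5 : ℚ) * (X ^ (2 * 1) * G) +
        C (10 : ℚ) * (X ^ (2 * 1 + 1) * G) + C (-10 : ℚ) * (X ^ (2 * 2) * G) +
        C (5 : ℚ) * (X ^ (2 * 2 + 1) * G) + C (-1 : ℚ) * (X ^ (2 * 3) * G) := by
    intro G
    simp only [map_neg, map_ofNat, map_one]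
    ring
  rw [h]
  simp only [map_add, coeff_C_mul, coeff_X_pow_even_mul, coeff_X_pow_odd_mul]
  ring

theorem coeff_X_mul_one_sub_X_pow_7_mul (d m : ℕ) :
    coeff (2 * m) (X * ((1 - X) ^ 7 * ((1 + X : ℚ⟦X⟧)⁻¹ * (1 - X)⁻¹) ^ (d + 1))) =
      -(7 * evenCoeff d m 1 + 35 * evenCoeff d m 2 + 21 * evenCoeff d m 3 + evenCoeff d m 4) := by
  have h : ∀ G : ℚ⟦X⟧, X * ((1 - X) ^ 7 * G) =
        C (1 : ℚ) * (X ^ (2 * 0 + 1) * G) + C (-7 : ℚ) * (X ^ (2 * 1) * G) +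
        C (21 : ℚ) * (X ^ (2 * 1 + 1) * G) + C (-35 : ℚ) * (X ^ (2 * 2) * G) +
        C (35 : ℚ) * (X ^ (2 * 2 + 1) * G) + C (-21 : ℚ) * (X ^ (2 * 3) * G) +
        C (7 : ℚ) * (X ^ (2 * 3 + 1) * G) + C (-1 : ℚ) * (X ^ (2 * 4) * G) := by
    intro G
    simp only [map_neg, map_ofNat, map_one]
    ring
  rw [h]
  simp only [map_add, coeff_C_mul, coeff_X_pow_even_mul, coeff_X_pow_odd_mul]
  ring

theorem coeff_X_mul_one_sub_X_pow_8_mul (d m : ℕ) :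
    coeff (2 * m) (X * ((1 - X) ^ 8 * ((1 + X : ℚ⟦X⟧)⁻¹ * (1 - X)⁻¹) ^ (d + 1))) =
      -(8 * evenCoeff d m 1 + 56 * evenCoeff d m 2 + 56 * evenCoeff d m 3 + 8 * evenCoeff d m 4) := by
  have h : ∀ G : ℚ⟦X⟧, X * ((1 - X) ^ 8 * G) =
        C (1 : ℚ) * (X ^ (2 * 0 + 1) * G) + C (-8 : ℚ) * (X ^ (2 * 1) * G) +
        C (28 : ℚ) * (X ^ (2 * 1 + 1) * G) + C (-56 : ℚ) * (X ^ (2 * 2) * G) +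
        C (70 : ℚ) * (X ^ (2 * 2 + 1) * G) + C (-56 : ℚ) * (X ^ (2 * 3) * G) +
        C (28 : ℚ) * (X ^ (2 * 3 + 1) * G) + C (-8 : ℚ) * (X ^ (2 * 4) * G) +
        C (1 : ℚ) * (X ^ (2 * 4 + 1) * G) := by
    intro G
    simp only [map_neg, map_ofNat, map_one]
    ring
  rw [h]
  simp only [map_add, coeff_C_mul, coeff_X_pow_even_mul, coeff_X_pow_odd_mul]
  ring

theorem coeff_X_mul_one_sub_X_pow_10_mul (d m : ℕ) :
    coeff (2 * m) (X * ((1 - X) ^ 10 * ((1 + X : ℚ⟦X⟧)⁻¹ * (1 - X)⁻¹) ^ (d + 1))) =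
      -(10 * evenCoeff d m 1 + 120 * evenCoeff d m 2 + 252 * evenCoeff d m 3 + 120 * evenCoeff d m 4 + 10 * evenCoeff d m 5) := by
  have h : ∀ G : ℚ⟦X⟧, X * ((1 - X) ^ 10 * G) =
        C (1 : ℚ) * (X ^ (2 * 0 + 1) * G) + C (-10 : ℚ) * (X ^ (2 * 1) * G) +
        C (45 : ℚ) * (X ^ (2 * 1 + 1) * G) + C (-120 : ℚ) * (X ^ (2 * 2) * G) +
        C (210 : ℚ) * (X ^ (2 * 2 + 1) * G) + C (-252 : ℚ) * (X ^ (2 * 3) * G) +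
        C (210 : ℚ) * (X ^ (2 * 3 + 1) * G) + C (-120 : ℚ) * (X ^ (2 * 4) * G) +
        C (45 : ℚ) * (X ^ (2 * 4 + 1) * G) + C (-10 : ℚ) * (X ^ (2 * 5) * G) +
        C (1 : ℚ) * (X ^ (2 * 5 + 1) * G) := by
    intro G
    simp only [map_neg, map_ofNat, map_one]
    ring
  rw [h]
  simp only [map_add, coeff_C_mul, coeff_X_pow_even_mul, coeff_X_pow_odd_mul]
  ring

theorem coeff_one_sub_X_pow_1_mul (d m : ℕ) :
    coeff (2 * m) ((1 - X) ^ 1 * ((1 + X : ℚ⟦X⟧)⁻¹ * (1 - X)⁻¹) ^ (d + 1)) =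
      evenCoeff d m 0 := by
  have h : ∀ G : ℚ⟦X⟧, (1 - X) ^ 1 * G =
        C (1 : ℚ) * (X ^ (2 * 0) * G) + C (-1 : ℚ) * (X ^ (2 * 0 + 1) * G) := by
    intro G
    simp only [map_neg, map_one]
    ring
  rw [h]
  simp only [map_add, coeff_C_mul, coeff_X_pow_even_mul, coeff_X_pow_odd_mul]
  ring

theorem coeff_one_sub_X_pow_2_mul (d m : ℕ) :
    coeff (2 * m) ((1 - X) ^ 2 * ((1 + X : ℚ⟦X⟧)⁻¹ * (1 - X)⁻¹) ^ (d + 1)) =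
      evenCoeff d m 0 + evenCoeff d m 1 := by
  have h : ∀ G : ℚ⟦X⟧, (1 - X) ^ 2 * G =
        C (1 : ℚ) * (X ^ (2 * 0) * G) + C (-2 : ℚ) * (X ^ (2 * 0 + 1) * G) +
        C (1 : ℚ) * (X ^ (2 * 1) * G) := by
    intro G
    simp only [map_neg, map_ofNat, map_one]
    ring
  rw [h]
  simp only [map_add, coeff_C_mul, coeff_X_pow_even_mul, coeff_X_pow_odd_mul]
  ring

theorem coeff_one_sub_X_pow_4_mul (d m : ℕ) :
    coeff (2 * m) ((1 - X) ^ 4 * ((1 + X : ℚ⟦X⟧)⁻¹ * (1 - X)⁻¹) ^ (d + 1)) =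
      evenCoeff d m 0 + 6 * evenCoeff d m 1 + evenCoeff d m 2 := by
  have h : ∀ G : ℚ⟦X⟧, (1 - X) ^ 4 * G =
        C (1 : ℚ) * (X ^ (2 * 0) * G) + C (-4 : ℚ) * (X ^ (2 * 0 + 1) * G) +
        C (6 : ℚ) * (X ^ (2 * 1) * G) + C (-4 : ℚ) * (X ^ (2 * 1 + 1) * G) +
        C (1 : ℚ) * (X ^ (2 * 2) * G) := by
    intro G
    simp only [map_neg, map_ofNat, map_one]
    ring
  rw [h]
  simp only [map_add, coeff_C_mul, coeff_X_pow_even_mul, coeff_X_pow_odd_mul]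
  ring

/-- Here `1 - X` has the larger exponent, and the polynomial factor is `1 + X`. This occurs only for
length `24m + 8`. -/
theorem coeff_one_add_X_mul_inv_pow (d m : ℕ) :
    coeff (2 * m) ((1 + X : ℚ⟦X⟧)⁻¹ ^ d * (1 - X : ℚ⟦X⟧)⁻¹ ^ (d + 1)) = evenCoeff d m 0 := by
  have h : (1 + X : ℚ⟦X⟧)⁻¹ ^ d * (1 - X : ℚ⟦X⟧)⁻¹ ^ (d + 1) =
      X ^ (2 * 0) * ((1 + X : ℚ⟦X⟧)⁻¹ * (1 - X)⁻¹) ^ (d + 1) +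
      X ^ (2 * 0 + 1) * ((1 + X : ℚ⟦X⟧)⁻¹ * (1 - X)⁻¹) ^ (d + 1) := by
    rw [mul_pow, pow_succ (1 + X : ℚ⟦X⟧)⁻¹]
    linear_combination (-(1 + X : ℚ⟦X⟧)⁻¹ ^ d * (1 - X : ℚ⟦X⟧)⁻¹ ^ (d + 1)) * one_add_X_mul_inv
  rw [h, map_add, coeff_X_pow_even_mul, coeff_X_pow_odd_mul, add_zero]

end Evaluation

/-! ### Closed forms for the four lengths. -/

section Evaluation

open PowerSeries

theorem cast_choose_add_left_eq (k m a : ℕ) :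
    ((k + a + m).choose m : ℚ) = (k + m).choose m *
      ((∏ i ∈ Finset.range a, ((k : ℚ) + m + i + 1)) /
        ∏ i ∈ Finset.range a, ((k : ℚ) + i + 1)) := by
  simpa using cast_choose_add_eq k m a 0

theorem cast_choose_add_right_eq (k m b : ℕ) :
    ((k + (m + b)).choose (m + b) : ℚ) = (k + m).choose m *
      ((∏ i ∈ Finset.range b, ((k : ℚ) + m + i + 1)) /
        ∏ i ∈ Finset.range b, ((m : ℚ) + i + 1)) := by
  simpa using cast_choose_add_eq k m 0 b

/-- A binomial coefficient with `m - 1`, in terms of the one with `m`. -/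
theorem cast_choose_pred_eq {m : ℕ} (hm : 1 ≤ m) :
    ((5 * m + 1).choose (m - 1) : ℚ) = (4 * m + 1 + m).choose m * m / (4 * m + 2) := by
  obtain ⟨k, rfl⟩ := Nat.exists_eq_add_of_le' hm
  have h := Nat.choose_succ_right_eq (5 * (k + 1) + 1) k
  rw [show 5 * (k + 1) + 1 - k = 4 * (k + 1) + 2 by omega] at h
  rw [eq_div_iff (by positivity), Nat.add_sub_cancel,
    show 4 * (k + 1) + 1 + (k + 1) = 5 * (k + 1) + 1 by ring]
  exact_mod_cast h.symm

/-- Once each term is a rational multiple of `choose (5m) m`, the claim is an identity of rational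
functions in `m`. The other three lengths go the same way. -/
theorem evaluation_eight {m : ℕ} (hm : 1 ≤ m) :
    -(2 ^ 4 * ((12 * m + 4) / (2 * m) * coeff (2 * m)
        (X * ((1 + X)⁻¹ ^ (4 * m + 4 + 1) * (1 - X)⁻¹ ^ (4 * m)))))
      - coeff m ((1 + X : ℚ⟦X⟧) * (1 - X : ℚ⟦X⟧)⁻¹ ^ (4 * m + 1))
      + (4 * m + 2) * (coeff (m - 1) ((1 + X : ℚ⟦X⟧) * (1 - X : ℚ⟦X⟧)⁻¹ ^ (4 * m + 2 + 1))
        - 2 ^ 4 / 64 * ((12 * m + 4) / (2 * m + 1) * coeff (2 * m)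
          ((1 + X)⁻¹ ^ (4 * m + 4 - 3) * (1 - X)⁻¹ ^ (4 * m + 2)))) = forcedCoeff8 m := by
  have hm0 : (m : ℚ) ≠ 0 := by positivity
  rw [add_assoc (4 * m) 4, inv_pow_mul_inv_pow_eq, show 4 * m + (4 + 1) = 4 * m + 4 + 1 by ring,
    coeff_X_mul_one_sub_X_pow_5_mul, coeff_one_add_X_mul (by omega),
    coeff_one_add_X_mul (by omega),
    show 4 * m + 4 - 3 = 4 * m + 1 by omega, show 4 * m + 2 = 4 * m + 1 + 1 by ring,
    coeff_one_add_X_mul_inv_pow,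
    evenCoeff_succ_eq (4 * m + 4) m 2 (z := 5 * m + 2) (by push_cast; ring) (by positivity),
    evenCoeff_succ_eq (4 * m + 4) m 1 (z := 5 * m + 3) (by push_cast; ring) (by positivity),
    evenCoeff_succ_eq (4 * m + 4) m 0 (z := 5 * m + 4) (by push_cast; ring) (by positivity),
    evenCoeff_zero, evenCoeff_zero, forcedCoeff8,
    Nat.choose_symm_add, Nat.choose_symm_add, show 4 * m + 1 + 1 + (m - 1) = 5 * m + 1 by omega,
    cast_choose_pred_eq hm, Nat.cast_sub hm,
    cast_choose_add_left_eq (4 * m) m 4, cast_choose_add_left_eq (4 * m) m 1]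
  generalize ((4 * m + m).choose m : ℚ) = y
  simp only [Finset.prod_range_succ, Finset.prod_range_zero]
  push_cast
  -- Removes the subtraction from a denominator, so that it is visibly nonzero.
  rw [show 4 * (m : ℚ) + 1 + 1 + (m - 1) = 5 * m + 1 by ring]
  field_simp
  ring

theorem evaluation_twelve {m : ℕ} (hm : 1 ≤ m) :
    -(2 ^ 6 * ((12 * m + 6) / (2 * m) * coeff (2 * m)
        (X * ((1 + X)⁻¹ ^ (4 * m + 6 + 1) * (1 - X)⁻¹ ^ (4 * m)))))
      - coeff (m + 1) ((1 + X : ℚ⟦X⟧) * (1 - X : ℚ⟦X⟧)⁻¹ ^ (4 * m + 1))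
      + (4 * m + 2) * (coeff m ((1 + X : ℚ⟦X⟧) * (1 - X : ℚ⟦X⟧)⁻¹ ^ (4 * m + 2 + 1))
        - 2 ^ 6 / 64 * ((12 * m + 6) / (2 * m + 1) * coeff (2 * m)
          ((1 + X)⁻¹ ^ (4 * m + 6 - 3) * (1 - X)⁻¹ ^ (4 * m + 2)))) = forcedCoeff12 m := by
  have hm0 : (m : ℚ) ≠ 0 := by positivity
  rw [add_assoc (4 * m) 6, inv_pow_mul_inv_pow_eq, show 4 * m + (6 + 1) = 4 * m + 6 + 1 by ring,
    coeff_X_mul_one_sub_X_pow_7_mul, coeff_one_add_X_mul (by omega),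
    coeff_one_add_X_mul (by omega),
    show 4 * m + 6 - 3 = 4 * m + 2 + 1 by omega,
    inv_pow_mul_inv_pow_eq, coeff_one_sub_X_pow_1_mul,
    evenCoeff_succ_eq (4 * m + 6) m 3 (z := 5 * m + 3) (by push_cast; ring) (by positivity),
    evenCoeff_succ_eq (4 * m + 6) m 2 (z := 5 * m + 4) (by push_cast; ring) (by positivity),
    evenCoeff_succ_eq (4 * m + 6) m 1 (z := 5 * m + 5) (by push_cast; ring) (by positivity),
    evenCoeff_succ_eq (4 * m + 6) m 0 (z := 5 * m + 6) (by push_cast; ring) (by positivity),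
    evenCoeff_zero, evenCoeff_zero, forcedCoeff12,
    Nat.choose_symm_add, Nat.choose_symm_add, show 5 * m + 2 = 4 * m + 1 + (m + 1) by ring,
    cast_choose_add_eq (4 * m) m 1 1, cast_choose_add_left_eq (4 * m) m 6, cast_choose_add_left_eq (4 * m) m 2,
    cast_choose_add_right_eq (4 * m) m 1]
  generalize ((4 * m + m).choose m : ℚ) = y
  simp only [Finset.prod_range_succ, Finset.prod_range_zero]
  push_cast
  field_simp
  ring

theorem evaluation_fourteen {m : ℕ} (hm : 1 ≤ m) :
    -(2 ^ 7 * ((12 * m + 7) / (2 * m) * coeff (2 * m)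
        (X * ((1 + X)⁻¹ ^ (4 * m + 7 + 1) * (1 - X)⁻¹ ^ (4 * m)))))
      - coeff (m + 1) ((1 + X : ℚ⟦X⟧) * (1 - X : ℚ⟦X⟧)⁻¹ ^ (4 * m + 1))
      + (4 * m + 2) * (coeff m ((1 + X : ℚ⟦X⟧) * (1 - X : ℚ⟦X⟧)⁻¹ ^ (4 * m + 2 + 1))
        - 2 ^ 7 / 64 * ((12 * m + 7) / (2 * m + 1) * coeff (2 * m)
          ((1 + X)⁻¹ ^ (4 * m + 7 - 3) * (1 - X)⁻¹ ^ (4 * m + 2)))) = forcedCoeff14 m := by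
  have hm0 : (m : ℚ) ≠ 0 := by positivity
  rw [add_assoc (4 * m) 7, inv_pow_mul_inv_pow_eq, show 4 * m + (7 + 1) = 4 * m + 7 + 1 by ring,
    coeff_X_mul_one_sub_X_pow_8_mul, coeff_one_add_X_mul (by omega),
    coeff_one_add_X_mul (by omega),
    show 4 * m + 7 - 3 = 4 * m + 2 + 2 by omega,
    inv_pow_mul_inv_pow_eq, show 4 * m + 2 + 2 = 4 * m + 3 + 1 by ring, coeff_one_sub_X_pow_2_mul,
    evenCoeff_succ_eq (4 * m + 7) m 3 (z := 5 * m + 4) (by push_cast; ring) (by positivity),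
    evenCoeff_succ_eq (4 * m + 7) m 2 (z := 5 * m + 5) (by push_cast; ring) (by positivity),
    evenCoeff_succ_eq (4 * m + 7) m 1 (z := 5 * m + 6) (by push_cast; ring) (by positivity),
    evenCoeff_succ_eq (4 * m + 7) m 0 (z := 5 * m + 7) (by push_cast; ring) (by positivity),
    evenCoeff_succ_eq (4 * m + 3) m 0 (z := 5 * m + 3) (by push_cast; ring) (by positivity),
    evenCoeff_zero, evenCoeff_zero, forcedCoeff14,
    Nat.choose_symm_add, Nat.choose_symm_add, show 5 * m + 2 = 4 * m + 1 + (m + 1) by ring,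
    cast_choose_add_eq (4 * m) m 1 1, cast_choose_add_left_eq (4 * m) m 7, cast_choose_add_left_eq (4 * m) m 3,
    cast_choose_add_left_eq (4 * m) m 2, cast_choose_add_right_eq (4 * m) m 1]
  generalize ((4 * m + m).choose m : ℚ) = y
  simp only [Finset.prod_range_succ, Finset.prod_range_zero]
  push_cast
  field_simp
  ring

theorem evaluation_eighteen {m : ℕ} (hm : 1 ≤ m) :
    -(2 ^ 9 * ((12 * m + 9) / (2 * m) * coeff (2 * m)
        (X * ((1 + X)⁻¹ ^ (4 * m + 9 + 1) * (1 - X)⁻¹ ^ (4 * m)))))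
      - coeff (m + 2) ((1 + X : ℚ⟦X⟧) * (1 - X : ℚ⟦X⟧)⁻¹ ^ (4 * m + 1))
      + (4 * m + 2) * (coeff (m + 1) ((1 + X : ℚ⟦X⟧) * (1 - X : ℚ⟦X⟧)⁻¹ ^ (4 * m + 2 + 1))
        - 2 ^ 9 / 64 * ((12 * m + 9) / (2 * m + 1) * coeff (2 * m)
          ((1 + X)⁻¹ ^ (4 * m + 9 - 3) * (1 - X)⁻¹ ^ (4 * m + 2)))) = forcedCoeff18 m := by
  have hm0 : (m : ℚ) ≠ 0 := by positivity
  rw [add_assoc (4 * m) 9, inv_pow_mul_inv_pow_eq, show 4 * m + (9 + 1) = 4 * m + 9 + 1 by ring,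
    coeff_X_mul_one_sub_X_pow_10_mul, coeff_one_add_X_mul (by omega),
    coeff_one_add_X_mul (by omega),
    show 4 * m + 9 - 3 = 4 * m + 2 + 4 by omega,
    inv_pow_mul_inv_pow_eq, show 4 * m + 2 + 4 = 4 * m + 5 + 1 by ring, coeff_one_sub_X_pow_4_mul,
    evenCoeff_succ_eq (4 * m + 9) m 4 (z := 5 * m + 5) (by push_cast; ring) (by positivity),
    evenCoeff_succ_eq (4 * m + 9) m 3 (z := 5 * m + 6) (by push_cast; ring) (by positivity),
    evenCoeff_succ_eq (4 * m + 9) m 2 (z := 5 * m + 7) (by push_cast; ring) (by positivity),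
    evenCoeff_succ_eq (4 * m + 9) m 1 (z := 5 * m + 8) (by push_cast; ring) (by positivity),
    evenCoeff_succ_eq (4 * m + 9) m 0 (z := 5 * m + 9) (by push_cast; ring) (by positivity),
    evenCoeff_succ_eq (4 * m + 5) m 1 (z := 5 * m + 4) (by push_cast; ring) (by positivity),
    evenCoeff_succ_eq (4 * m + 5) m 0 (z := 5 * m + 5) (by push_cast; ring) (by positivity),
    evenCoeff_zero, evenCoeff_zero, forcedCoeff18,
    Nat.choose_symm_add, Nat.choose_symm_add, show 5 * m + 3 = 4 * m + 1 + (m + 2) by ring,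
    cast_choose_add_eq (4 * m) m 1 2, cast_choose_add_eq (4 * m) m 2 1, cast_choose_add_left_eq (4 * m) m 9, cast_choose_add_left_eq (4 * m) m 5,
    cast_choose_add_right_eq (4 * m) m 2]
  generalize ((4 * m + m).choose m : ℚ) = y
  simp only [Finset.prod_range_succ, Finset.prod_range_zero]
  push_cast
  field_simp
  ring

end Evaluation

/-! ### Sign of the closed forms beyond the thresholds. -/

section Negativity

/-- After the shift `m = 53 + k`, the negated cubic has only positive coefficients in `k`. The other
lengths use the same shift by their thresholds. -/
theorem forcedCoeff8_neg {m : ℕ} (hm : 53 ≤ m) : forcedCoeff8 m < 0 := by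
  obtain ⟨k, rfl⟩ := Nat.exists_eq_add_of_le hm
  have hc : (0 : ℚ) < (5 * (53 + k) + 1).choose (53 + k - 1) := by
    exact_mod_cast Nat.choose_pos (by omega)
  refine mul_neg_of_neg_of_pos (div_neg_of_neg_of_pos ?_ (by positivity)) hc
  refine mul_neg_of_pos_of_neg (by positivity) (neg_pos.1 ?_)
  push_cast
  ring_nf
  positivity

theorem forcedCoeff12_neg {m : ℕ} (hm : 142 ≤ m) : forcedCoeff12 m < 0 := by
  obtain ⟨k, rfl⟩ := Nat.exists_eq_add_of_le hm
  have hc : (0 : ℚ) < (5 * (142 + k) + 2).choose (142 + k + 1) := by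
    exact_mod_cast Nat.choose_pos (by omega)
  refine mul_neg_of_neg_of_pos (div_neg_of_neg_of_pos ?_ (by positivity)) hc
  refine mul_neg_of_pos_of_neg (by positivity) (neg_pos.1 ?_)
  push_cast
  ring_nf
  positivity

theorem forcedCoeff14_neg {m : ℕ} (hm : 146 ≤ m) : forcedCoeff14 m < 0 := by
  obtain ⟨k, rfl⟩ := Nat.exists_eq_add_of_le hm
  have hc : (0 : ℚ) < (5 * (146 + k) + 2).choose (146 + k + 1) := by
    exact_mod_cast Nat.choose_pos (by omega)
  refine mul_neg_of_neg_of_pos (div_neg_of_neg_of_pos ?_ (by positivity)) hc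
  refine mul_neg_of_pos_of_neg (by positivity) (neg_pos.1 ?_)
  push_cast
  ring_nf
  positivity

theorem forcedCoeff18_neg {m : ℕ} (hm : 157 ≤ m) : forcedCoeff18 m < 0 := by
  obtain ⟨k, rfl⟩ := Nat.exists_eq_add_of_le hm
  have hc : (0 : ℚ) < (5 * (157 + k) + 3).choose (157 + k + 2) := by
    exact_mod_cast Nat.choose_pos (by omega)
  refine mul_neg_of_neg_of_pos (div_neg_of_neg_of_pos ?_ (by positivity)) hc
  refine mul_neg_of_pos_of_neg (by positivity) (neg_pos.1 ?_)
  push_cast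
  ring_nf
  positivity

end Negativity

/-! ### The four families of lengths. -/

section Main

theorem IsExtremalWithMinimalShadow.shadowCoeff_eq {n : ℕ} {D : BinaryCode n}
    (hD : IsExtremalWithMinimalShadow D) {m ε j : ℕ} (hn : n / 24 = m) (hn22 : n % 24 ≠ 22)
    (hε : minimalShadowWeight n = 4 * ε + n % 8 / 2)
    (hj : 4 * j + n % 8 / 2 + minimalShadowWeight n < 4 * m + 4) :
    shadowCoeff D j = if j = ε then 1 else 0 := by
  have hd := hD.extremal
  rw [extremalDistance, if_neg hn22, hn] at hd
  exact shadowCoeff_eq_ite hD.selfDual hD.singlyEven hd hD.minimalShadow hε hj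

theorem IsExtremalWithMinimalShadow.shadowCoeff_eight {m : ℕ} (hm : 1 ≤ m)
    {D : BinaryCode (24 * m + 8)} (hD : IsExtremalWithMinimalShadow D) :
    (shadowCoeff D (m + 1) : ℚ) = forcedCoeff8 m := by
  have hn : (24 * m + 8) / 24 = m := by omega
  have h8 : (24 * m + 8) % 8 / 2 = 0 := by omega
  have hw : minimalShadowWeight (24 * m + 8) = 4 := by rw [minimalShadowWeight, if_pos h8]
  have hd := hD.extremal
  rw [extremalDistance, if_neg (by omega), hn] at hd
  -- For `r = 0` the minimal weight 4 sits at index `ε = 1`; in the other lengths it is `r`, at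
  -- index 0.
  have h := shadowCoeff_eq_of_sparse hD.selfDual hD.singlyEven (m := m) (s := 4) (M := m) (ε := 1)
    (by ring) hm (by omega) (by omega) hm hm hd
    fun j hj => hD.shadowCoeff_eq hn (by omega) (by omega) (by omega)
  exact h.trans (by exact_mod_cast evaluation_eight hm)

theorem IsExtremalWithMinimalShadow.shadowCoeff_twelve {m : ℕ} (hm : 1 ≤ m)
    {D : BinaryCode (24 * m + 12)} (hD : IsExtremalWithMinimalShadow D) :
    (shadowCoeff D (m + 1) : ℚ) = forcedCoeff12 m := by
  have hn : (24 * m + 12) / 24 = m := by omega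
  have h8 : (24 * m + 12) % 8 / 2 = 2 := by omega
  have hw : minimalShadowWeight (24 * m + 12) = 2 := by simp [minimalShadowWeight, h8]
  have hd := hD.extremal
  rw [extremalDistance, if_neg (by omega), hn] at hd
  have h := shadowCoeff_eq_of_sparse hD.selfDual hD.singlyEven (m := m) (s := 6) (M := m) (ε := 0)
    (by ring) hm (by omega) (by omega) hm (by omega) hd
    fun j hj => hD.shadowCoeff_eq hn (by omega) (by omega) (by omega)
  exact h.trans (by exact_mod_cast evaluation_twelve hm)

theorem IsExtremalWithMinimalShadow.shadowCoeff_fourteen {m : ℕ} (hm : 1 ≤ m)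
    {D : BinaryCode (24 * m + 14)} (hD : IsExtremalWithMinimalShadow D) :
    (shadowCoeff D (m + 1) : ℚ) = forcedCoeff14 m := by
  have hn : (24 * m + 14) / 24 = m := by omega
  have h8 : (24 * m + 14) % 8 / 2 = 3 := by omega
  have hw : minimalShadowWeight (24 * m + 14) = 3 := by simp [minimalShadowWeight, h8]
  have hd := hD.extremal
  rw [extremalDistance, if_neg (by omega), hn] at hd
  have h := shadowCoeff_eq_of_sparse hD.selfDual hD.singlyEven (m := m) (s := 7) (M := m) (ε := 0)
    (by ring) hm (by omega) (by omega) hm (by omega) hd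
    fun j hj => hD.shadowCoeff_eq hn (by omega) (by omega) (by omega)
  exact h.trans (by exact_mod_cast evaluation_fourteen hm)

theorem IsExtremalWithMinimalShadow.shadowCoeff_eighteen {m : ℕ} (hm : 1 ≤ m)
    {D : BinaryCode (24 * m + 18)} (hD : IsExtremalWithMinimalShadow D) :
    (shadowCoeff D (m + 2) : ℚ) = forcedCoeff18 m := by
  have hn : (24 * m + 18) / 24 = m := by omega
  have h8 : (24 * m + 18) % 8 / 2 = 1 := by omega
  have hw : minimalShadowWeight (24 * m + 18) = 1 := by simp [minimalShadowWeight, h8]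
  have hd := hD.extremal
  rw [extremalDistance, if_neg (by omega), hn] at hd
  -- Since `9 / 4 = 2`, one more shadow coefficient is known than for the other lengths, and the
  -- forced one is `b_(m+2)`.
  have h := shadowCoeff_eq_of_sparse hD.selfDual hD.singlyEven (m := m) (s := 9) (M := m + 1)
    (ε := 0) (by ring) hm (by omega) (by omega) (by omega) (by omega) hd
    fun j hj => hD.shadowCoeff_eq hn (by omega) (by omega) (by omega)
  exact h.trans (by exact_mod_cast evaluation_eighteen hm)

end Main

theorem mainTheorem3 :
    -- length `24m + 8`
    ((∀ m : ℕ, 53 ≤ m → ¬ ∃ C : BinaryCode (24 * m + 8), IsExtremalWithMinimalShadow C) ∧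
      (∀ m : ℕ, 1 ≤ m → ∀ C : BinaryCode (24 * m + 8), IsExtremalWithMinimalShadow C →
        (shadowCoeff C (m + 1) : ℚ) = forcedCoeff8 m) ∧
      (∀ m : ℕ, 53 ≤ m → forcedCoeff8 m < 0)) ∧
    -- length `24m + 12`
    ((∀ m : ℕ, 142 ≤ m → ¬ ∃ C : BinaryCode (24 * m + 12), IsExtremalWithMinimalShadow C) ∧
      (∀ m : ℕ, 1 ≤ m → ∀ C : BinaryCode (24 * m + 12), IsExtremalWithMinimalShadow C →
        (shadowCoeff C (m + 1) : ℚ) = forcedCoeff12 m) ∧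
      (∀ m : ℕ, 142 ≤ m → forcedCoeff12 m < 0)) ∧
    -- length `24m + 14`
    ((∀ m : ℕ, 146 ≤ m → ¬ ∃ C : BinaryCode (24 * m + 14), IsExtremalWithMinimalShadow C) ∧
      (∀ m : ℕ, 1 ≤ m → ∀ C : BinaryCode (24 * m + 14), IsExtremalWithMinimalShadow C →
        (shadowCoeff C (m + 1) : ℚ) = forcedCoeff14 m) ∧
      (∀ m : ℕ, 146 ≤ m → forcedCoeff14 m < 0)) ∧
    -- length `24m + 18`
    ((∀ m : ℕ, 157 ≤ m → ¬ ∃ C : BinaryCode (24 * m + 18), IsExtremalWithMinimalShadow C) ∧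
      (∀ m : ℕ, 1 ≤ m → ∀ C : BinaryCode (24 * m + 18), IsExtremalWithMinimalShadow C →
        (shadowCoeff C (m + 2) : ℚ) = forcedCoeff18 m) ∧
      (∀ m : ℕ, 157 ≤ m → forcedCoeff18 m < 0)) := by
  -- A number of shadow vectors cannot be negative.
  have absurd_of_neg : ∀ {a : ℕ} {b : ℚ}, (a : ℚ) = b → ¬ b < 0 := fun h hb =>
    absurd (h ▸ Nat.cast_nonneg _) (not_le.2 hb)
  refine ⟨⟨?_, fun m hm D hD => hD.shadowCoeff_eight hm, fun m hm => forcedCoeff8_neg hm⟩,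
    ⟨?_, fun m hm D hD => hD.shadowCoeff_twelve hm, fun m hm => forcedCoeff12_neg hm⟩,
    ⟨?_, fun m hm D hD => hD.shadowCoeff_fourteen hm, fun m hm => forcedCoeff14_neg hm⟩,
    ⟨?_, fun m hm D hD => hD.shadowCoeff_eighteen hm, fun m hm => forcedCoeff18_neg hm⟩⟩
  · rintro m hm ⟨D, hD⟩
    exact absurd_of_neg (hD.shadowCoeff_eight (by omega)) (forcedCoeff8_neg hm)
  · rintro m hm ⟨D, hD⟩
    exact absurd_of_neg (hD.shadowCoeff_twelve (by omega)) (forcedCoeff12_neg hm)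
  · rintro m hm ⟨D, hD⟩
    exact absurd_of_neg (hD.shadowCoeff_fourteen (by omega)) (forcedCoeff14_neg hm)
  · rintro m hm ⟨D, hD⟩
    exact absurd_of_neg (hD.shadowCoeff_eighteen (by omega)) (forcedCoeff18_neg hm)
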